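/- **Setting.** $\hat{\mathbb C}$ is the Riemann sphere with the chordal metric, length element $ds=2|dz|/(1+|z|^2)$ and area $dA$; $S(z,r)$ is the circle of centre $z$ and radius $r$ in this metric. A domain is a non-empty connected open set, and $\mathcal C(G)$ denotes the set of components of $\hat{\mathbb C}\setminus G$. A disk is a closed disk of $\hat{\mathbb C}$, possibly of radius $0$. An *exhaustion* of a domain $D$ is a sequence of domains $D_1\subset D_2\subset\cdots$ with $\bigcup_j D_j=D$, each bounded by finitely many disjoint Jordan curves in $D$. An exhaustion $(D_j)$ is a *refinement* of an exhaustion $(D_j')$ of $D$ if for every $j$ each $q\in\mathcal C(D_j)$ belongs to $\mathcal C(D'_k)$ for some $k\ge j$. For a domain $G$ let $\hat G$ be the quotient space of $\hat{\mathbb C}$ in which each $q\in\mathcal C(G)$ is collapsed to a point, with quotient map $\pi_G$; thus $\hat G=G\cup\mathcal C(G)$. The *transboundary modulus* of a family $\Gamma$ of paths in $\hat G$ is $$\operatorname{mod}(\Gamma)=\inf_\rho\Big(\int_G\rho^2\,dA+\sum_{q\in\mathcal C(G)}\rho(q)^2\Big),$$ the infimum being over the Borel functions $\rho:\hat G\to[0,\infty]$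 such that $\int_\gamma\rho\,ds+\sum_{q\in\mathcal C(G)\cap|\gamma|}\rho(q)\ge1$ for all $\gamma\in\Gamma$; here $|\gamma|$ is the image of $\gamma$, and $\int_\gamma\rho\,ds$ is the path integral over the part of $\gamma$ in $G$. Let $\operatorname{mod}(A,B;G)$ be the modulus of the family of all paths in $\hat G$ joining $\pi_G(A)$ and $\pi_G(B)$, and, for $P\in\mathcal C(G)$, let $\operatorname{mod}_P(A,B;G)$ be the modulus of the family of those among these paths that do not pass through the point $\pi_G(P)$. **Proposition 2.4.** Let $D\subset\hat{\mathbb C}$ be a domain with countably many complementary components. Let $(D_j')$ be an exhaustion of $D$ such that, whenever $q_1\in\mathcal C(D'_{j_1})$, $q_2\in\mathcal C(D'_{j_2})$, $j_1\ge j_2$ and $q_1\cap q_2\ne\emptyset$, either $q_1=q_2$ or $q_1$ lies in the interior of $q_2$. Let $p\in\mathcal C(D)$, and let $U$ be an open neighborhood of $p$ such that $\overline U\in\mathcal C(D_n')$ for some $n$. Suppose that every $q\in\mathcal C(D)\setminus\{p\}$ with $q\subset U$ is a disk. Then $(D_j')$ has a refinement $(D_j(p))$ with $$D_j(p)\setminus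 U=D_j'\setminus U\quad\text{for all }j$$ such that every refinement $(D_j)$ of $(D_j(p))$ satisfies, for every $z\in p$, $$\lim_{r\to0}\limsup_{j\to\infty}\operatorname{mod}_{p_j}(S(z,r)\setminus p_j,\partial U;D_j)=0,$$ where $p_j$ is the element of $\mathcal C(D_j)$ containing $p$. If $p$ is a single point, then moreover $$\lim_{r\to0}\limsup_{j\to\infty}\operatorname{mod}(S(z,r)\setminus p_j,\partial U;D_j)=0\quad\text{for } z\in p.$$ -/

import Mathlib

open Set Filter Topology MeasureTheory
open scoped ENNReal unitInterval

namespace PlanarExhaustion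

/-! ### The Riemann sphere

The Riemann sphere is the unit sphere of Euclidean 3-space, identified with the extended plane by
stereographic projection. Its metric is the chordal one, whose length element is
`2 |dz| / (1 + |z| ^ 2)`, and whose closed balls are the closed spherical disks. -/

/-- The Riemann sphere with its chordal metric. -/
abbrev RSphere : Type := Metric.sphere (0 : EuclideanSpace ℝ (Fin 3)) 1

/-- Surface area on the Riemann sphere (total mass `4 π`). -/
noncomputable def area : Measure RSphere :=
  (volume : Measure (EuclideanSpace ℝ (Fin 3))).toSphere

/-- A domain: a non-empty connected open set. -/
def IsDom (G : Set RSphere) : Prop := IsOpen G ∧ IsConnected G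

/-- The set of complementary components of `G`. -/
def complComps (G : Set RSphere) : Set (Set RSphere) :=
  {q | ∃ x ∈ Gᶜ, q = connectedComponentIn Gᶜ x}

/-- Countably connected domains: the complement has countably many (possibly finitely many)
components. -/
def IsCountablyConnected (G : Set RSphere) : Prop := IsDom G ∧ (complComps G).Countable

/-- Closed disks; the radius may be zero. -/
def IsClosedDisk (q : Set RSphere) : Prop :=
  ∃ x : RSphere, ∃ r : ℝ, 0 ≤ r ∧ q = Metric.closedBall x r

/-- Jordan curves: homeomorphic images of the circle. -/
def IsJordanCurve (J : Set RSphere) : Prop :=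
  ∃ f : Circle → RSphere, Continuous f ∧ Function.Injective f ∧ range f = J

/-- An exhaustion of `D`: an increasing sequence of domains with union `D`, the boundary of each
being the union of finitely many disjoint Jordan curves in `D`. -/
structure IsExhaustion (D : Set RSphere) (E : ℕ → Set RSphere) : Prop where
  isDom : ∀ j, IsDom (E j)
  subset : ∀ j, E j ⊆ D
  bounded_by_jordan : ∀ j, ∃ 𝒥 : Set (Set RSphere), 𝒥.Finite ∧ 𝒥.PairwiseDisjoint id ∧
    (∀ J ∈ 𝒥, IsJordanCurve J ∧ J ⊆ D) ∧ frontier (E j) = ⋃₀ 𝒥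
  mono : ∀ j, E j ⊆ E (j + 1)
  iUnion_eq : ⋃ j, E j = D

/-- `E` refines `F`: each complementary component of `E j` is one of some `F k` with `k ≥ j`. -/
def IsRefinement (E F : ℕ → Set RSphere) : Prop :=
  ∀ j, ∀ q ∈ complComps (E j), ∃ k, j ≤ k ∧ q ∈ complComps (F k)

/-- Intersecting complementary components of two members of the sequence are equal, or the one of
the later member lies in the interior of the other. -/
def IsStrictlyNested (E : ℕ → Set RSphere) : Prop :=
  ∀ j₁ j₂, j₂ ≤ j₁ → ∀ q₁ ∈ complComps (E j₁), ∀ q₂ ∈ complComps (E j₂),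
    (q₁ ∩ q₂).Nonempty → q₁ = q₂ ∨ q₁ ⊆ interior q₂

/-- The complementary component of `G` that contains the set `p`
(see `compOver_mem` and `eq_compOver`). -/
def compOver (G p : Set RSphere) : Set RSphere := ⋃₀ {q | q ∈ complComps G ∧ p ⊆ q}

/-! ### The quotient space -/

theorem complComps_eq_of_mem {G q q' : Set RSphere} {x : RSphere} (hq : q ∈ complComps G)
    (hq' : q' ∈ complComps G) (hx : x ∈ q) (hx' : x ∈ q') : q = q' := by
  obtain ⟨a, -, rfl⟩ := hq
  obtain ⟨b, -, rfl⟩ := hq'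
  rw [connectedComponentIn_eq hx, connectedComponentIn_eq hx']

/-- If `G ⊆ D` and `p` is a complementary component of `D`, then `compOver G p` is a complementary
component of `G` containing `p`. -/
theorem compOver_mem {D G p : Set RSphere} (hG : G ⊆ D) (hp : p ∈ complComps D) :
    compOver G p ∈ complComps G ∧ p ⊆ compOver G p := by
  obtain ⟨x, hx, rfl⟩ := hp
  have hxG : x ∈ Gᶜ := fun h => hx (hG h)
  have hsub : connectedComponentIn Dᶜ x ⊆ connectedComponentIn Gᶜ x :=
    connectedComponentIn_mono x (compl_subset_compl.2 hG)
  have key : compOver G (connectedComponentIn Dᶜ x) = connectedComponentIn Gᶜ x := by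
    apply Subset.antisymm
    · rintro y ⟨q, ⟨hq, hpq⟩, hy⟩
      have : q = connectedComponentIn Gᶜ x :=
        complComps_eq_of_mem hq ⟨x, hxG, rfl⟩ (hpq (mem_connectedComponentIn hx))
          (mem_connectedComponentIn hxG)
      exact this ▸ hy
    · exact fun y hy => ⟨_, ⟨⟨x, hxG, rfl⟩, hsub⟩, hy⟩
  rw [key]
  exact ⟨⟨x, hxG, rfl⟩, hsub⟩

/-- Uniqueness of the complementary component containing `p`. -/
theorem eq_compOver {D G p q : Set RSphere} (hG : G ⊆ D) (hp : p ∈ complComps D)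
    (hq : q ∈ complComps G) (hpq : p ⊆ q) : q = compOver G p := by
  obtain ⟨h1, h2⟩ := compOver_mem hG hp
  obtain ⟨x, hx, rfl⟩ := hp
  have hx' := mem_connectedComponentIn hx
  exact complComps_eq_of_mem hq h1 (hpq hx') (h2 hx')

/-- The equivalence relation collapsing each complementary component of `G` to a point. -/
def collapse (G : Set RSphere) : Setoid RSphere where
  r x y := x = y ∨ ∃ q ∈ complComps G, x ∈ q ∧ y ∈ q
  iseqv :=
    { refl := fun _ => Or.inl rfl
      symm := by
        rintro x y (rfl | ⟨q, hq, hx, hy⟩)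
        · exact Or.inl rfl
        · exact Or.inr ⟨q, hq, hy, hx⟩
      trans := by
        rintro x y z (rfl | ⟨q, hq, hx, hy⟩) (rfl | ⟨q', hq', hy', hz⟩)
        · exact Or.inl rfl
        · exact Or.inr ⟨q', hq', hy', hz⟩
        · exact Or.inr ⟨q, hq, hx, hy⟩
        · exact Or.inr ⟨q, hq, hx, complComps_eq_of_mem hq hq' hy hy' ▸ hz⟩ }

/-- The quotient of the sphere in which each complementary component of `G` is a point. -/
def Hat (G : Set RSphere) : Type := Quotient (collapse G)

/-- The quotient topology. -/
instance (G : Set RSphere) : TopologicalSpace (Hat G) :=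
  inferInstanceAs (TopologicalSpace (Quotient (collapse G)))

/-- The Borel sets of the quotient topology. -/
instance (G : Set RSphere) : MeasurableSpace (Hat G) := borel (Hat G)

instance (G : Set RSphere) : BorelSpace (Hat G) := ⟨rfl⟩

/-- The quotient map. -/
def proj (G : Set RSphere) : RSphere → Hat G := Quotient.mk (collapse G)

/-- A representative of a point of the quotient; for a point of `proj G '' G` it is the unique one,
so that it identifies `proj G '' G` with `G`. -/
noncomputable def rep (G : Set RSphere) : Hat G → RSphere := fun w => Quotient.out w

/-- The points of the quotient that are collapsed complementary components. -/
def compPts (G : Set RSphere) : Set (Hat G) := proj G '' Gᶜ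

theorem rep_proj {G : Set RSphere} {x : RSphere} (hx : x ∈ G) : rep G (proj G x) = x := by
  have h : (collapse G).r (rep G (proj G x)) x := Quotient.exact (Quotient.out_eq (proj G x))
  rcases h with h | ⟨q, ⟨y, -, rfl⟩, -, hxq⟩
  · exact h
  · exact absurd hx (connectedComponentIn_subset _ _ hxq)

/-! ### Path integrals and transboundary modulus -/

/-- The integral of `g` with respect to arc length over the restriction of the path `f` to
`[a, b]`, through the parametrization by arc length; it is `∞` if the restriction is not
rectifiable. -/
noncomputable def arcIntegral (f : I → RSphere) (g : RSphere → ℝ≥0∞) (a b : I) : ℝ≥0∞ :=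
  open Classical in
  if eVariationOn f (Icc a b) = ∞ then ∞
  else ∫⁻ u in Icc (0 : ℝ) (eVariationOn f (Icc a b)).toReal,
    g (naturalParameterization f (Icc a b) a u)

/-- The integral over the restriction of `f` to an interval `J` that need not be closed: the
supremum over the closed subintervals. -/
noncomputable def intervalArcIntegral (f : I → RSphere) (g : RSphere → ℝ≥0∞) (J : Set I) : ℝ≥0∞ :=
  ⨆ (a : I) (b : I) (_ : a ≤ b) (_ : Icc a b ⊆ J), arcIntegral f g a b

/-- The parameters at which a path in the quotient lies in `G`. -/
def paramsIn (G : Set RSphere) (γ : C(I, Hat G)) : Set I := {t | γ t ∈ proj G '' G}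

/-- The integral of `ρ` over the restriction of `γ` to `G`: the sum over the maximal subintervals
on which `γ` lies in `G`. -/
noncomputable def pathIntegral (G : Set RSphere) (ρ : Hat G → ℝ≥0∞) (γ : C(I, Hat G)) : ℝ≥0∞ :=
  ∑' J : {J : Set I // ∃ t ∈ paramsIn G γ, J = connectedComponentIn (paramsIn G γ) t},
    intervalArcIntegral (fun t => rep G (γ t)) (fun x => ρ (proj G x)) J

/-- Admissible densities of a path family: Borel functions for which every path of the family has
length at least one, counting the collapsed components that it meets as atoms. -/
def IsAdmissible (G : Set RSphere) (Γ : Set C(I, Hat G)) (ρ : Hat G → ℝ≥0∞) : Prop :=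
  Measurable ρ ∧ ∀ γ ∈ Γ,
    1 ≤ pathIntegral G ρ γ + ∑' w : (compPts G ∩ range γ : Set (Hat G)), ρ w

/-- The transboundary modulus of a family of paths in the quotient. -/
noncomputable def transboundaryMod (G : Set RSphere) (Γ : Set C(I, Hat G)) : ℝ≥0∞ :=
  ⨅ (ρ : Hat G → ℝ≥0∞) (_ : IsAdmissible G Γ ρ),
    (∫⁻ x in G, ρ (proj G x) ^ 2 ∂area) + ∑' w : compPts G, ρ w ^ 2

/-- The paths in the quotient that join the images of `A` and `B`. -/
def joiningPaths (G A B : Set RSphere) : Set C(I, Hat G) :=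
  {γ | γ 0 ∈ proj G '' A ∧ γ 1 ∈ proj G '' B}

/-- The paths of the quotient that do not pass through the image of `P`. -/
def avoidingPaths (G P : Set RSphere) : Set C(I, Hat G) :=
  {γ | Disjoint (range γ) (proj G '' P)}

/-- The modulus of all paths in the quotient that join the images of `A` and `B`. -/
noncomputable def modJoin (G A B : Set RSphere) : ℝ≥0∞ :=
  transboundaryMod G (joiningPaths G A B)

/-- The modulus of the paths in the quotient that join the images of `A` and `B` and do not pass
through the image of `P`. -/
noncomputable def modJoinAvoiding (G A B P : Set RSphere) : ℝ≥0∞ :=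
  transboundaryMod G (joiningPaths G A B ∩ avoidingPaths G P)

end PlanarExhaustion

namespace PlanarExhaustion

/-! ### Topology of the sphere and of complementary components -/

/-! The refinement makes the complementary components near `p` almost equal to disks; a logarithmic
density then bounds the modulus, as it would for honest disks.

Construction (`exists_refinement`). As `D` has countably many complementary components, there are
errors `ε j q > 0`, decreasing in `j`, whose sum over `q` is at most `δ j → 0`. Let `K ⊆ U` be the
component of some `(D' m)ᶜ` containing `p`. Inside `K`, at stage `j ≥ m`, each `q` is covered by its
component at the first level `k ≥ j` at which that component lies in the `ε j q'`-neighbourhood of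
some component `q'` of `Dᶜ` that it contains. Choosing the first such level makes these sets
pairwise equal or disjoint, compactness makes them finite in number, and the complement of their
union stays connected. A further refinement only moves to later stages, where the errors are no
larger. Hence each of its components meeting a small ball around `z ∈ p`, except the one over `p`,
is a disk up to a small error.

Modulus (`transboundaryMod_le`). Take `N` annuli `τ n < |x - z| < 2 * τ n` with density `1 / (N * τ
n)`, and give each collapsed component the weighted length of its image under `x ↦ |x - z|`. A
crossing path is admissible because the images of its part in the domain and of the components it
meets cover the whole range of radii (`stepMeasure_Ioo_le_length`). The domain contributes `O(1 /
N)`. A disk has area comparable to the square of its radius even after restriction to the scale of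
an annulus, so by disjointness the squared image lengths in one annulus sum to `O(τ n ^ 2)`
(`sum_sq_volume_le`). The annuli are spaced so widely that no component other than the one over `p`
meets two of them (`exists_scale`); thus squaring an atom's weight creates no cross terms and the
atoms also contribute `O(1 / N)`.

The component over `p` receives weight zero. This is harmless when the paths avoid it, and also when
`p` is a point, since that component then eventually lies inside all the annuli. -/

instance : PreconnectedSpace RSphere := by
  refine isPreconnected_iff_preconnectedSpace.1 (isPreconnected_sphere ?_ 0 1)
  rw [← Module.finrank_eq_rank, finrank_euclideanSpace_fin]
  norm_num

instance : LocallyConnectedSpace RSphere :=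
  haveI : Fact (Module.finrank ℝ (EuclideanSpace ℝ (Fin 3)) = 2 + 1) := ⟨by simp⟩
  ChartedSpace.locallyConnectedSpace (EuclideanSpace ℝ (Fin 2)) RSphere

theorem inter_frontier_nonempty {X : Type*} [TopologicalSpace X] {T A : Set X}
    (hT : IsPreconnected T) (h1 : (T ∩ A).Nonempty) (h2 : (T ∩ Aᶜ).Nonempty) :
    (T ∩ frontier A).Nonempty := by
  by_contra h
  rw [not_nonempty_iff_eq_empty] at h
  have hx : ∀ x ∈ T, x ∈ frontier A → False := fun x hx hf => by
    have : x ∈ T ∩ frontier A := ⟨hx, hf⟩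
    rw [h] at this
    exact this
  obtain ⟨x, hxT, hxA⟩ := h1
  obtain ⟨y, hyT, hyA⟩ := h2
  obtain ⟨w, -, hw1, hw2⟩ := hT (interior A) (closure A)ᶜ isOpen_interior
    isClosed_closure.isOpen_compl
    (fun w hw => by
      by_cases hwA : w ∈ interior A
      · exact Or.inl hwA
      · exact Or.inr fun hc => hx w hw ⟨hc, hwA⟩)
    ⟨x, hxT, by_contra fun hi => hx x hxT ⟨subset_closure hxA, hi⟩⟩
    ⟨y, hyT, fun hc => hx y hyT ⟨hc, fun hi => hyA (interior_subset hi)⟩⟩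
  exact hw2 (subset_closure (interior_subset hw1))

theorem isClosed_sUnion_of_finite {X : Type*} [TopologicalSpace X] {F : Set (Set X)}
    (hF : F.Finite) (h : ∀ Q ∈ F, IsClosed Q) : IsClosed (⋃₀ F) := by
  rw [sUnion_eq_biUnion]
  exact hF.isClosed_biUnion h

theorem frontier_nonempty_of_ne_univ {A : Set RSphere} (h1 : A.Nonempty) (h2 : Aᶜ.Nonempty) :
    (frontier A).Nonempty := by
  have := inter_frontier_nonempty (T := (univ : Set RSphere)) isPreconnected_univ
    (A := A) (by simpa using h1) (by simpa using h2)
  simpa using this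

section Components

variable {G q : Set RSphere}

theorem complComps_nonempty (hq : q ∈ complComps G) : q.Nonempty := by
  obtain ⟨x, hx, rfl⟩ := hq
  exact ⟨x, mem_connectedComponentIn hx⟩

theorem complComps_isPreconnected (hq : q ∈ complComps G) : IsPreconnected q := by
  obtain ⟨x, hx, rfl⟩ := hq
  exact isPreconnected_connectedComponentIn

theorem complComps_subset (hq : q ∈ complComps G) : q ⊆ Gᶜ := by
  obtain ⟨x, hx, rfl⟩ := hq
  exact connectedComponentIn_subset _ _

theorem subset_of_meets_complComps (hq : q ∈ complComps G) {T : Set RSphere}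
    (hT : IsPreconnected T) (hTG : T ⊆ Gᶜ) (h : (T ∩ q).Nonempty) : T ⊆ q := by
  obtain ⟨x, hx, rfl⟩ := hq
  obtain ⟨y, hyT, hy⟩ := h
  rw [connectedComponentIn_eq hy]
  exact hT.subset_connectedComponentIn hyT hTG

theorem complComps_isClosed (hG : IsOpen G) (hq : q ∈ complComps G) : IsClosed q := by
  refine isClosed_of_closure_subset (subset_of_meets_complComps hq
    (complComps_isPreconnected hq).closure
    (closure_minimal (complComps_subset hq) hG.isClosed_compl) ?_)
  obtain ⟨x, hx⟩ := complComps_nonempty hq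
  exact ⟨x, subset_closure hx, hx⟩

theorem exists_mem_complComps {x : RSphere} (hx : x ∉ G) : ∃ q ∈ complComps G, x ∈ q :=
  ⟨_, ⟨x, hx, rfl⟩, mem_connectedComponentIn hx⟩

/-- By local connectedness, a point of `q` off `closure G` has a connected neighbourhood in the
complement of `G`, and this must lie in `q`. -/
theorem frontier_complComps (hG : IsOpen G) (hq : q ∈ complComps G) :
    frontier q = q ∩ frontier G := by
  have hcl := complComps_isClosed hG hq
  ext x
  constructor
  · intro hx
    have hxq : x ∈ q := hcl.frontier_subset hx
    refine ⟨hxq, ?_, fun h => complComps_subset hq hxq (interior_subset h)⟩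
    by_contra hxG
    refine hx.2 ?_
    have hn : (closure G)ᶜ ∈ 𝓝 x := isClosed_closure.isOpen_compl.mem_nhds hxG
    refine mem_interior_iff_mem_nhds.2 (mem_of_superset (connectedComponentIn_mem_nhds hn) ?_)
    refine subset_of_meets_complComps hq isPreconnected_connectedComponentIn
      ((connectedComponentIn_subset _ _).trans (compl_subset_compl.2 subset_closure))
      ⟨x, mem_connectedComponentIn hxG, hxq⟩
  · rintro ⟨hxq, hxG⟩
    refine ⟨subset_closure hxq, fun h => ?_⟩
    obtain ⟨y, hy, hyG⟩ := mem_closure_iff.1 hxG.1 _ isOpen_interior h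
    exact complComps_subset hq (interior_subset hy) hyG

theorem IsJordanCurve.isPreconnected {J : Set RSphere} (hJ : IsJordanCurve J) :
    IsPreconnected J := by
  obtain ⟨f, hf, -, rfl⟩ := hJ
  have h : IsPreconnected (univ : Set Circle) := by
    have : range Circle.exp = univ := Circle.exp_surjective.range_eq
    rw [← this]
    exact isPreconnected_range Circle.exp.continuous
  rw [← image_univ]
  exact h.image f hf.continuousOn

/-- The frontier of each component meets one of the curves, and a connected curve off `G` meets only
one component. So the finitely many curves determine all the components. -/
theorem complComps_finite_of_jordan (hG : IsDom G) {𝒥 : Set (Set RSphere)} (hfin : 𝒥.Finite)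
    (hJ : ∀ J ∈ 𝒥, IsJordanCurve J) (hfr : frontier G = ⋃₀ 𝒥) : (complComps G).Finite := by
  refine (hfin.image fun J => ⋃₀ {q | q ∈ complComps G ∧ (J ∩ q).Nonempty}).subset ?_
  intro q hq
  obtain ⟨x, hx⟩ := frontier_nonempty_of_ne_univ (complComps_nonempty hq)
    (hG.2.nonempty.mono fun y hy h => complComps_subset hq h hy)
  rw [frontier_complComps hG.1 hq, hfr] at hx
  obtain ⟨hxq, J, hJm, hxJ⟩ := hx
  have hJG : J ⊆ Gᶜ := fun y hy h => by
    have hyf : y ∈ frontier G := hfr ▸ ⟨J, hJm, hy⟩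
    exact hyf.2 (hG.1.interior_eq.symm ▸ h)
  have hJq := subset_of_meets_complComps hq (hJ J hJm).isPreconnected hJG ⟨x, hxJ, hxq⟩
  refine ⟨J, hJm, Subset.antisymm ?_ fun y hy => ⟨q, ⟨hq, x, hxJ, hxq⟩, hy⟩⟩
  rintro y ⟨q', ⟨hq', w, hwJ, hwq'⟩, hy⟩
  exact complComps_eq_of_mem hq' hq hwq' (hJq hwJ) ▸ hy

end Components

/-! ### Exhaustions -/

section Exhaustion

variable {D : Set RSphere} {E : ℕ → Set RSphere} (hE : IsExhaustion D E)
include hE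

theorem IsExhaustion.monotone : Monotone E := monotone_nat_of_le_succ hE.mono

theorem IsExhaustion.finite_complComps (k : ℕ) : (complComps (E k)).Finite := by
  obtain ⟨𝒥, h1, -, h2, h3⟩ := hE.bounded_by_jordan k
  exact complComps_finite_of_jordan (hE.isDom k) h1 (fun J hJ => (h2 J hJ).1) h3

theorem IsExhaustion.isClosed_comp {k : ℕ} {Q : Set RSphere} (hQ : Q ∈ complComps (E k)) :
    IsClosed Q := complComps_isClosed (hE.isDom k).1 hQ

theorem IsExhaustion.nested {k l : ℕ} (hkl : k ≤ l) {Q R : Set RSphere}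
    (hQ : Q ∈ complComps (E k)) (hR : R ∈ complComps (E l)) (h : (Q ∩ R).Nonempty) : R ⊆ Q :=
  subset_of_meets_complComps hQ (complComps_isPreconnected hR)
    ((complComps_subset hR).trans (compl_subset_compl.2 (hE.monotone hkl))) (inter_comm Q R ▸ h)

theorem IsExhaustion.isOpen : IsOpen D := by
  rw [← hE.iUnion_eq]
  exact isOpen_iUnion fun j => (hE.isDom j).1

theorem IsExhaustion.subset_comp_of_meets {k : ℕ} {Q q : Set RSphere}
    (hQ : Q ∈ complComps (E k)) (hq : q ∈ complComps D) (h : (q ∩ Q).Nonempty) : q ⊆ Q :=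
  subset_of_meets_complComps hQ (complComps_isPreconnected hq)
    ((complComps_subset hq).trans (compl_subset_compl.2 (hE.subset k))) h

theorem IsExhaustion.exists_jordan_frontier {k : ℕ} {Q : Set RSphere}
    (hQ : Q ∈ complComps (E k)) :
    ∃ 𝒥 : Set (Set RSphere), 𝒥.Finite ∧ 𝒥.PairwiseDisjoint id ∧
      (∀ J ∈ 𝒥, IsJordanCurve J ∧ J ⊆ D) ∧ frontier Q = ⋃₀ 𝒥 := by
  obtain ⟨𝒥, h1, h2, h3, h4⟩ := hE.bounded_by_jordan k
  refine ⟨{J ∈ 𝒥 | (J ∩ Q).Nonempty}, h1.subset fun J h => h.1, h2.subset fun J h => h.1,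
    fun J h => h3 J h.1, ?_⟩
  rw [frontier_complComps (hE.isDom k).1 hQ, h4]
  ext x
  constructor
  · rintro ⟨hxQ, J, hJ, hx⟩
    exact ⟨J, ⟨hJ, x, hx, hxQ⟩, hx⟩
  · rintro ⟨J, ⟨hJ, hne⟩, hx⟩
    refine ⟨subset_of_meets_complComps hQ (h3 J hJ).1.isPreconnected (fun y hy h => ?_) hne hx,
      J, hJ, hx⟩
    have hyf : y ∈ frontier (E k) := h4 ▸ ⟨J, hJ, hy⟩
    exact hyf.2 ((hE.isDom k).1.interior_eq.symm ▸ h)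

/-- The boundary curves lie in `D`, so no point of the complement of `D` is on the frontier of `Q`.
-/
theorem IsExhaustion.inter_compl_subset_interior {k : ℕ} {Q : Set RSphere}
    (hQ : Q ∈ complComps (E k)) : Q ∩ Dᶜ ⊆ interior Q := by
  rintro x ⟨hxQ, hxD⟩
  by_contra h
  obtain ⟨𝒥, -, -, h3, h4⟩ := hE.exists_jordan_frontier hQ
  have : x ∈ frontier Q := ⟨subset_closure hxQ, h⟩
  rw [h4] at this
  obtain ⟨J, hJ, hx⟩ := this
  exact hxD ((h3 J hJ).2 hx)

theorem IsExhaustion.compOver_mem (k : ℕ) {q : Set RSphere} (hq : q ∈ complComps D) :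
    compOver (E k) q ∈ complComps (E k) := (PlanarExhaustion.compOver_mem (hE.subset k) hq).1

theorem IsExhaustion.subset_compOver (k : ℕ) {q : Set RSphere} (hq : q ∈ complComps D) :
    q ⊆ compOver (E k) q := (PlanarExhaustion.compOver_mem (hE.subset k) hq).2

theorem IsExhaustion.compOver_anti {k l : ℕ} (hkl : k ≤ l) {q : Set RSphere}
    (hq : q ∈ complComps D) : compOver (E l) q ⊆ compOver (E k) q := by
  obtain ⟨x, hx⟩ := complComps_nonempty hq
  exact hE.nested hkl (hE.compOver_mem k hq) (hE.compOver_mem l hq)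
    ⟨x, hE.subset_compOver k hq hx, hE.subset_compOver l hq hx⟩

/-- A decreasing intersection of compact connected sets is connected: a separation of it would
already separate some member. The intersection misses `D` because the domains exhaust `D`. -/
theorem IsExhaustion.iInter_compOver {q : Set RSphere} (hq : q ∈ complComps D) :
    ⋂ k, compOver (E k) q = q := by
  have hclosed : ∀ k, IsClosed (compOver (E k) q) := fun k => hE.isClosed_comp (hE.compOver_mem k hq)
  have hL : IsClosed (⋂ k, compOver (E k) q) := isClosed_iInter hclosed
  have hdir : Directed (fun s t => s ⊇ t) fun k => compOver (E k) q :=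
    directed_of_isDirected_le fun k l hkl => hE.compOver_anti hkl hq
  refine Subset.antisymm (subset_of_meets_complComps hq ?_ ?_ ?_)
    (subset_iInter fun k => hE.subset_compOver k hq)
  · rw [isPreconnected_iff_subset_of_fully_disjoint_closed hL]
    intro u v hu hv huv hd
    obtain ⟨u', v', hu', hv', huu', hvv', hd'⟩ := normal_separation hu hv hd
    obtain ⟨k, hk⟩ := exists_subset_nhds_of_isCompact hdir (fun k => (hclosed k).isCompact)
      (U := u' ∪ v') fun x hx => (hu'.union hv').mem_nhds (union_subset_union huu' hvv' (huv hx))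
    rcases (complComps_isPreconnected (hE.compOver_mem k hq)).subset_or_subset hu' hv' hd' hk
      with h | h
    · left
      intro x hx
      refine (huv hx).resolve_right fun hxv => disjoint_left.1 hd' (h (mem_iInter.1 hx k)) (hvv' hxv)
    · right
      intro x hx
      refine (huv hx).resolve_left fun hxv => disjoint_left.1 hd' (huu' hxv) (h (mem_iInter.1 hx k))
  · intro x hx hxD
    rw [← hE.iUnion_eq] at hxD
    obtain ⟨k, hk⟩ := mem_iUnion.1 hxD
    exact complComps_subset (hE.compOver_mem k hq) (mem_iInter.1 hx k) hk
  · obtain ⟨x, hx⟩ := complComps_nonempty hq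
    exact ⟨x, mem_iInter.2 fun k => hE.subset_compOver k hq hx, hx⟩

theorem IsExhaustion.eventually_compOver_subset {q O : Set RSphere} (hq : q ∈ complComps D)
    (hO : IsOpen O) (hqO : q ⊆ O) : ∃ k₀, ∀ k ≥ k₀, compOver (E k) q ⊆ O := by
  obtain ⟨k, hk⟩ := exists_subset_nhds_of_isCompact (V := fun k => compOver (E k) q) (U := O)
    (directed_of_isDirected_le fun k l hkl => hE.compOver_anti hkl hq)
    (fun k => (hE.isClosed_comp (hE.compOver_mem k hq)).isCompact)
    (fun x hx => hO.mem_nhds (hqO (by rwa [hE.iInter_compOver hq] at hx)))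
  exact ⟨k, fun l hl => (hE.compOver_anti hl hq).trans hk⟩

end Exhaustion

/-! ### Domains bounded by components of various members of an exhaustion -/

section Family

variable {D : Set RSphere} {E : ℕ → Set RSphere} (hE : IsExhaustion D E)
  {F : Set (Set RSphere)} {j : ℕ} (hF : ∀ Q ∈ F, ∃ k, j ≤ k ∧ Q ∈ complComps (E k))
include hE hF

theorem IsExhaustion.subset_compl_sUnion : E j ⊆ (⋃₀ F)ᶜ := by
  rintro x hx ⟨Q, hQ, hxQ⟩
  obtain ⟨k, hjk, hk⟩ := hF Q hQ
  exact complComps_subset hk hxQ (hE.monotone hjk hx)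

/-- Only connectedness is at stake. A component `W` of the complement that missed `E j` would miss
every later domain of the exhaustion; but its frontier lies in the members of `F`, and it would then
be swallowed by one of them. -/
theorem IsExhaustion.isDom_compl_sUnion (hfin : F.Finite) : IsDom (⋃₀ F)ᶜ := by
  have hcl : IsClosed (⋃₀ F) := isClosed_sUnion_of_finite hfin fun Q hQ => by
    obtain ⟨k, -, hk⟩ := hF Q hQ
    exact hE.isClosed_comp hk
  have hsub := hE.subset_compl_sUnion hF
  obtain ⟨x₀, hx₀⟩ := (hE.isDom j).2.nonempty
  refine ⟨hcl.isOpen_compl, ⟨x₀, hsub hx₀⟩, ?_⟩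
  suffices h : (⋃₀ F)ᶜ ⊆ connectedComponentIn (⋃₀ F)ᶜ x₀ by
    rw [Subset.antisymm h (connectedComponentIn_subset _ _)]
    exact isPreconnected_connectedComponentIn
  intro x hx
  set W := connectedComponentIn (⋃₀ F)ᶜ x with hW
  have hWo : IsOpen W := hcl.isOpen_compl.connectedComponentIn
  have hxW : x ∈ W := mem_connectedComponentIn hx
  have hWF : W ⊆ (⋃₀ F)ᶜ := connectedComponentIn_subset _ _
  by_cases hWj : (W ∩ E j).Nonempty
  · obtain ⟨y, hyW, hyE⟩ := hWj
    have h1 : connectedComponentIn (⋃₀ F)ᶜ x = connectedComponentIn (⋃₀ F)ᶜ y :=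
      connectedComponentIn_eq hyW
    have h2 : x₀ ∈ connectedComponentIn (⋃₀ F)ᶜ y :=
      (hE.isDom j).2.isPreconnected.subset_connectedComponentIn hyE hsub hx₀
    rw [← connectedComponentIn_eq h2, ← h1]
    exact hxW
  · exfalso
    have hfr : ∀ y ∈ frontier W, ∃ Q ∈ F, y ∈ Q := by
      intro y hy
      by_contra hyF
      have hyF' : y ∈ (⋃₀ F)ᶜ := fun ⟨Q, hQ, h⟩ => hyF ⟨Q, hQ, h⟩
      obtain ⟨w, hw1, hw2⟩ := mem_closure_iff.1 hy.1 _ (hcl.isOpen_compl.connectedComponentIn (x := y))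
        (mem_connectedComponentIn hyF')
      have h1 : connectedComponentIn (⋃₀ F)ᶜ y = W := by
        rw [connectedComponentIn_eq hw1, hW, connectedComponentIn_eq hw2]
      exact hy.2 (hWo.interior_eq.symm ▸ h1 ▸ mem_connectedComponentIn hyF')
    -- If `W` misses `E k`, its closure is a connected set off `E k`; touching a component `Q` of
    -- that complement, it lies in `Q`, although `W` avoids `⋃₀ F`.
    have key : ∀ k, W ∩ E k = ∅ → ∀ Q ∈ F, Q ∈ complComps (E k) → ∀ y ∈ closure W, y ∈ Q → False := by
      intro k hk Q hQF hQ y hyW hyQ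
      have hWc : closure W ⊆ (E k)ᶜ := closure_minimal
        (fun w hw hwE => (hk ▸ (⟨hw, hwE⟩ : w ∈ W ∩ E k) : w ∈ (∅ : Set RSphere)))
        (hE.isDom k).1.isClosed_compl
      have := subset_of_meets_complComps hQ isPreconnected_connectedComponentIn.closure hWc ⟨y, hyW, hyQ⟩
      exact hWF hxW ⟨Q, hQF, this (subset_closure hxW)⟩
    have hall : ∀ i, j ≤ i → W ∩ E i = ∅ := by
      intro i hi
      induction i, hi using Nat.le_induction with
      | base => exact not_nonempty_iff_eq_empty.1 hWj
      | succ i hi ih =>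
        by_contra hne
        obtain ⟨w, hwW, hwE⟩ := nonempty_iff_ne_empty.2 hne
        -- `E (i + 1)` is connected and contains `x₀ ∉ W`, so it crosses the frontier of `W` at a
        -- point of some `Q ∈ F`. If `Q` has level at most `i`, then `key` applies; otherwise `Q`
        -- misses `E (i + 1)`.
        obtain ⟨y, hyE, hyf⟩ := inter_frontier_nonempty (hE.isDom (i + 1)).2.isPreconnected
          (A := W) ⟨w, hwE, hwW⟩
          ⟨x₀, hE.monotone (by omega) hx₀, fun h => hWj ⟨x₀, h, hx₀⟩⟩
        obtain ⟨Q, hQF, hyQ⟩ := hfr y hyf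
        obtain ⟨k, -, hk⟩ := hF Q hQF
        by_cases hki : k ≤ i
        · refine key k (subset_empty_iff.1 ?_) Q hQF hk y hyf.1 hyQ
          rw [← ih]
          exact inter_subset_inter_right _ (hE.monotone hki)
        · exact complComps_subset hk hyQ (hE.monotone (by omega) hyE)
    obtain ⟨y, hy⟩ := frontier_nonempty_of_ne_univ ⟨x, hxW⟩
      ⟨x₀, fun h => hWj ⟨x₀, h, hx₀⟩⟩
    obtain ⟨Q, hQF, hyQ⟩ := hfr y hy
    obtain ⟨k, hjk, hk⟩ := hF Q hQF
    exact key k (hall k hjk) Q hQF hk y hy.1 hyQ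

theorem IsExhaustion.complComps_compl_sUnion (hfin : F.Finite) (hd : F.PairwiseDisjoint id) :
    complComps (⋃₀ F)ᶜ = F := by
  have hcl : ∀ Q ∈ F, IsClosed Q := fun Q hQ => by
    obtain ⟨k, -, hk⟩ := hF Q hQ
    exact hE.isClosed_comp hk
  have main : ∀ Q ∈ F, ∀ x ∈ Q, connectedComponentIn (⋃₀ F) x = Q := by
    intro Q hQ x hx
    obtain ⟨k, -, hk⟩ := hF Q hQ
    refine Subset.antisymm ?_ ((complComps_isPreconnected hk).subset_connectedComponentIn hx
      fun y hy => ⟨Q, hQ, hy⟩)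
    have hxF : x ∈ ⋃₀ F := ⟨Q, hQ, hx⟩
    have hcl' : IsClosed (⋃₀ (F \ {Q})) :=
      isClosed_sUnion_of_finite (hfin.subset sdiff_subset) fun R hR => hcl R hR.1
    have hdis : Disjoint Q (⋃₀ (F \ {Q})) := disjoint_sUnion_right.2 fun R hR =>
      hd hQ hR.1 (fun h => hR.2 h.symm)
    rcases (isPreconnected_iff_subset_of_disjoint_closed.1
      (isPreconnected_connectedComponentIn (F := ⋃₀ F) (x := x))) Q _ (hcl Q hQ) hcl'
      (fun y hy => by
        obtain ⟨R, hR, hyR⟩ := connectedComponentIn_subset _ _ hy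
        by_cases h : R = Q
        · exact Or.inl (h ▸ hyR)
        · exact Or.inr ⟨R, ⟨hR, h⟩, hyR⟩)
      (by rw [hdis.inter_eq, inter_empty]) with h | h
    · exact h
    · exact (disjoint_left.1 hdis hx (h (mem_connectedComponentIn hxF))).elim
  ext Q
  constructor
  · rintro ⟨x, hx, rfl⟩
    rw [compl_compl] at hx ⊢
    obtain ⟨Q, hQ, hxQ⟩ := hx
    rwa [main Q hQ x hxQ]
  · intro hQ
    obtain ⟨k, -, hk⟩ := hF Q hQ
    obtain ⟨x, hx⟩ := complComps_nonempty hk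
    refine ⟨x, ?_, ?_⟩
    · rw [compl_compl]; exact ⟨Q, hQ, hx⟩
    · rw [compl_compl, main Q hQ x hx]

theorem IsExhaustion.jordan_compl_sUnion (hfin : F.Finite) (hd : F.PairwiseDisjoint id) :
    ∃ 𝒥 : Set (Set RSphere), 𝒥.Finite ∧ 𝒥.PairwiseDisjoint id ∧
      (∀ J ∈ 𝒥, IsJordanCurve J ∧ J ⊆ D) ∧ frontier (⋃₀ F)ᶜ = ⋃₀ 𝒥 := by
  have hcl : ∀ Q ∈ F, IsClosed Q := fun Q hQ => by
    obtain ⟨k, -, hk⟩ := hF Q hQ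
    exact hE.isClosed_comp hk
  have hJ : ∀ Q ∈ F, ∃ 𝒥 : Set (Set RSphere), 𝒥.Finite ∧ 𝒥.PairwiseDisjoint id ∧
      (∀ J ∈ 𝒥, IsJordanCurve J ∧ J ⊆ D) ∧ frontier Q = ⋃₀ 𝒥 := fun Q hQ => by
    obtain ⟨k, -, hk⟩ := hF Q hQ
    exact hE.exists_jordan_frontier hk
  choose! 𝒥 h1 h2 h3 h4 using hJ
  have hsub : ∀ Q ∈ F, ∀ J ∈ 𝒥 Q, J ⊆ Q := fun Q hQ J hJ x hx =>
    (hcl Q hQ).frontier_subset (h4 Q hQ ▸ ⟨J, hJ, hx⟩)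
  refine ⟨⋃ Q ∈ F, 𝒥 Q, hfin.biUnion h1, ?_, ?_, ?_⟩
  · intro J hJ J' hJ' hne
    simp only [mem_iUnion, exists_prop] at hJ hJ'
    obtain ⟨Q, hQ, hJ⟩ := hJ
    obtain ⟨Q', hQ', hJ'⟩ := hJ'
    by_cases h : Q = Q'
    · subst h
      exact h2 Q hQ hJ hJ' hne
    · exact (hd hQ hQ' h).mono (hsub Q hQ J hJ) (hsub Q' hQ' J' hJ')
  · intro J hJ
    simp only [mem_iUnion, exists_prop] at hJ
    obtain ⟨Q, hQ, hJ⟩ := hJ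
    exact h3 Q hQ J hJ
  · rw [frontier_compl]
    have hclU : IsClosed (⋃₀ F) := isClosed_sUnion_of_finite hfin hcl
    have : frontier (⋃₀ F) = ⋃ Q ∈ F, frontier Q := by
      ext x
      simp only [mem_iUnion, exists_prop]
      constructor
      · intro hx
        obtain ⟨Q, hQ, hxQ⟩ := hclU.frontier_subset hx
        exact ⟨Q, hQ, subset_closure hxQ, fun h => hx.2 (interior_mono (subset_sUnion_of_mem hQ) h)⟩
      · rintro ⟨Q, hQ, hx⟩
        have hxQ := (hcl Q hQ).frontier_subset hx
        refine ⟨subset_closure ⟨Q, hQ, hxQ⟩, fun h => hx.2 ?_⟩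
        have hcl' : IsClosed (⋃₀ (F \ {Q})) :=
          isClosed_sUnion_of_finite (hfin.subset sdiff_subset) fun R hR => hcl R hR.1
        have hdis : Disjoint Q (⋃₀ (F \ {Q})) := disjoint_sUnion_right.2 fun R hR =>
          hd hQ hR.1 (fun h => hR.2 h.symm)
        refine mem_interior.2 ⟨interior (⋃₀ F) ∩ (⋃₀ (F \ {Q}))ᶜ, ?_,
          isOpen_interior.inter hcl'.isOpen_compl, h, disjoint_left.1 hdis hxQ⟩
        rintro y ⟨hy1, hy2⟩
        obtain ⟨R, hR, hyR⟩ := interior_subset hy1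
        by_cases hRQ : R = Q
        · exact hRQ ▸ hyR
        · exact (hy2 ⟨R, ⟨hR, hRQ⟩, hyR⟩).elim
    rw [this]
    ext x
    simp only [mem_iUnion, exists_prop, mem_sUnion]
    constructor
    · rintro ⟨Q, hQ, hx⟩
      rw [h4 Q hQ] at hx
      obtain ⟨J, hJ, hx⟩ := hx
      exact ⟨J, ⟨Q, hQ, hJ⟩, hx⟩
    · rintro ⟨J, ⟨Q, hQ, hJ⟩, hx⟩
      exact ⟨Q, hQ, h4 Q hQ ▸ ⟨J, hJ, hx⟩⟩

end Family

/-! ### The refinement -/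

/-- The component `Q` is approximated by a component `q` of the complement of `D` up to the error
`ε q`. -/
def IsApprox (D : Set RSphere) (ε : Set RSphere → ℝ) (Q : Set RSphere) : Prop :=
  ∃ q ∈ complComps D, q ⊆ Q ∧ Q ⊆ Metric.cthickening (ε q) q

theorem IsApprox.mono {D Q : Set RSphere} {ε ε' : Set RSphere → ℝ} (h : IsApprox D ε Q)
    (hε : ∀ q, ε q ≤ ε' q) : IsApprox D ε' Q := by
  obtain ⟨q, hq, h1, h2⟩ := h
  exact ⟨q, hq, h1, h2.trans (Metric.cthickening_mono (hε q) q)⟩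

section Construction

variable {D : Set RSphere} {E : ℕ → Set RSphere} (hE : IsExhaustion D E)
include hE

/-- The components over `q` shrink to `q`, so some level works and the least one is taken. The
approximated component need not be `q`: being approximate is a property of the set alone, which lets
different `q` in the same set share their level. -/
theorem IsExhaustion.exists_level {ε : Set RSphere → ℝ} (hε : ∀ q, 0 < ε q) (j : ℕ)
    {q : Set RSphere} (hq : q ∈ complComps D) :
    ∃ k, j ≤ k ∧ IsApprox D ε (compOver (E k) q) ∧
      ∀ k', j ≤ k' → IsApprox D ε (compOver (E k') q) → k ≤ k' := by
  classical
  have hex : ∃ k, j ≤ k ∧ IsApprox D ε (compOver (E k) q) := by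
    obtain ⟨k, hk⟩ := hE.eventually_compOver_subset hq
      (Metric.isOpen_thickening (δ := ε q)) (Metric.self_subset_thickening (hε q) q)
    exact ⟨max j k, le_max_left _ _, q, hq, hE.subset_compOver _ hq,
      (hk _ (le_max_right _ _)).trans (Metric.thickening_subset_cthickening _ _)⟩
  exact ⟨Nat.find hex, (Nat.find_spec hex).1, (Nat.find_spec hex).2,
    fun k' h1 h2 => Nat.find_min' hex ⟨h1, h2⟩⟩

/-- One stage of the refinement inside the component `K` of the complement of `E m`. -/
theorem IsExhaustion.refined_family {m : ℕ} {K : Set RSphere} (hK : K ∈ complComps (E m))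
    {ε : Set RSphere → ℝ} {j : ℕ} (hmj : m ≤ j) {lev : Set RSphere → ℕ}
    (hlev : ∀ q ∈ complComps D, j ≤ lev q ∧ IsApprox D ε (compOver (E (lev q)) q) ∧
      ∀ k', j ≤ k' → IsApprox D ε (compOver (E k') q) → lev q ≤ k') {F : Set (Set RSphere)}
    (hF : F = {Q | Q ∈ complComps (E j) ∧ ¬ Q ⊆ K} ∪
      {Q | ∃ q ∈ complComps D, q ⊆ K ∧ Q = compOver (E (lev q)) q}) :
    (∀ Q ∈ F, ∃ k, j ≤ k ∧ Q ∈ complComps (E k)) ∧ F.PairwiseDisjoint id ∧ F.Finite ∧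
      Dᶜ ⊆ ⋃₀ F ∧ (∀ Q ∈ F, Q ⊆ K → IsApprox D ε Q) ∧ (⋃₀ F)ᶜ \ K = E j \ K := by
  have hlevel : ∀ Q ∈ F, ∃ k, j ≤ k ∧ Q ∈ complComps (E k) := by
    intro Q hQ
    rw [hF] at hQ
    rcases hQ with hQ | ⟨q, hq, -, rfl⟩
    · exact ⟨j, le_rfl, hQ.1⟩
    · exact ⟨lev q, (hlev q hq).1, hE.compOver_mem _ hq⟩
  have hinK : ∀ q ∈ complComps D, q ⊆ K → compOver (E (lev q)) q ⊆ K := by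
    intro q hq hqK
    obtain ⟨x, hx⟩ := complComps_nonempty hq
    exact hE.nested (hmj.trans (hlev q hq).1) hK (hE.compOver_mem _ hq)
      ⟨x, hqK hx, hE.subset_compOver _ hq hx⟩
  have houtK : ∀ Q ∈ complComps (E j), ¬ Q ⊆ K → Disjoint Q K := by
    intro Q hQ hQK
    by_contra h
    rw [not_disjoint_iff_nonempty_inter, inter_comm] at h
    exact hQK (hE.nested hmj hK hQ h)
  -- If two chosen sets meet, the one of lower level contains the other. It is then also the
  -- component over `q₂` at that level and is already approximate, so minimality forces the levels
  -- to agree.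
  have hdisIn : ∀ q₁ ∈ complComps D, ∀ q₂ ∈ complComps D, lev q₁ ≤ lev q₂ →
      (compOver (E (lev q₁)) q₁ ∩ compOver (E (lev q₂)) q₂).Nonempty →
      compOver (E (lev q₁)) q₁ = compOver (E (lev q₂)) q₂ := by
    intro q₁ h₁ q₂ h₂ hle hne
    have hsub := hE.nested hle (hE.compOver_mem _ h₁) (hE.compOver_mem _ h₂) hne
    have hq₂ : q₂ ⊆ compOver (E (lev q₁)) q₁ := (hE.subset_compOver _ h₂).trans hsub
    have heq := eq_compOver (hE.subset _) h₂ (hE.compOver_mem _ h₁) hq₂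
    have hle' : lev q₂ ≤ lev q₁ := (hlev q₂ h₂).2.2 _ (hlev q₁ h₁).1 (heq ▸ (hlev q₁ h₁).2.1)
    rw [heq, le_antisymm hle hle']
  have hdisj : F.PairwiseDisjoint id := by
    intro Q hQ Q' hQ' hne
    by_contra hnd
    have hmeet : (Q ∩ Q').Nonempty := not_disjoint_iff_nonempty_inter.1 hnd
    rw [hF] at hQ hQ'
    rcases hQ with hQ | ⟨q, hq, hqK, rfl⟩ <;> rcases hQ' with hQ' | ⟨q', hq', hqK', rfl⟩
    · obtain ⟨x, hx, hx'⟩ := hmeet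
      exact hne (complComps_eq_of_mem hQ.1 hQ'.1 hx hx')
    · exact hnd ((houtK Q hQ.1 hQ.2).mono_right (hinK q' hq' hqK'))
    · exact hnd ((houtK Q' hQ'.1 hQ'.2).symm.mono_left (hinK q hq hqK))
    · rcases le_total (lev q) (lev q') with h | h
      · exact hne (hdisIn q hq q' hq' h hmeet)
      · exact hne (hdisIn q' hq' q hq h (inter_comm _ _ ▸ hmeet)).symm
  have hin : ∀ q ∈ complComps D, q ⊆ K → compOver (E (lev q)) q ∈ F := by
    intro q hq hqK
    rw [hF]
    exact Or.inr ⟨q, hq, hqK, rfl⟩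
  have hmeetK : ∀ q ∈ complComps D, (q ∩ K).Nonempty → q ⊆ K := fun q hq h =>
    hE.subset_comp_of_meets hK hq h
  refine ⟨hlevel, hdisj, ?_, ?_, ?_, ?_⟩
  · rw [hF]
    refine ((hE.finite_complComps j).subset fun Q hQ => hQ.1).union ?_
    -- The interiors of the chosen sets cover this compact set. By disjointness, every chosen set is
    -- one of those in a finite subcover.
    have hcomp : IsCompact (Dᶜ ∩ K) :=
      (hE.isOpen.isClosed_compl.inter (hE.isClosed_comp hK)).isCompact
    obtain ⟨t, htsub, htfin, ht⟩ := hcomp.elim_finite_subcover_image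
      (b := {q | q ∈ complComps D ∧ q ⊆ K}) (c := fun q => interior (compOver (E (lev q)) q))
      (fun q _ => isOpen_interior) (by
        rintro x ⟨hxD, hxK⟩
        obtain ⟨q, hq, hxq⟩ := exists_mem_complComps hxD
        refine mem_biUnion (x := q) ⟨hq, hmeetK q hq ⟨x, hxq, hxK⟩⟩ ?_
        exact hE.inter_compl_subset_interior (hE.compOver_mem _ hq)
          ⟨hE.subset_compOver _ hq hxq, hxD⟩)
    refine (htfin.image fun q => compOver (E (lev q)) q).subset ?_
    rintro Q ⟨q, hq, hqK, rfl⟩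
    obtain ⟨x, hx⟩ := complComps_nonempty hq
    obtain ⟨q', hq't, hxq'⟩ := mem_iUnion₂.1 (ht ⟨complComps_subset hq hx, hqK hx⟩)
    obtain ⟨hq', hq'K⟩ := htsub hq't
    refine ⟨q', hq't, by_contra fun hne => ?_⟩
    exact disjoint_left.1 (hdisj (hin q' hq' hq'K) (hin q hq hqK) hne) (interior_subset hxq')
      (hE.subset_compOver _ hq hx)
  · intro x hxD
    by_cases hxK : x ∈ K
    · obtain ⟨q, hq, hxq⟩ := exists_mem_complComps hxD
      exact ⟨_, hin q hq (hmeetK q hq ⟨x, hxq, hxK⟩), hE.subset_compOver _ hq hxq⟩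
    · obtain ⟨Q, hQ, hxQ⟩ := exists_mem_complComps (G := E j) fun h => hxD (hE.subset j h)
      exact ⟨Q, hF ▸ Or.inl ⟨hQ, fun h => hxK (h hxQ)⟩, hxQ⟩
  · intro Q hQ hQK
    rw [hF] at hQ
    rcases hQ with hQ | ⟨q, hq, -, rfl⟩
    · exact (hQ.2 hQK).elim
    · exact (hlev q hq).2.1
  · ext x
    simp only [Set.mem_sdiff, and_congr_left_iff]
    intro hxK
    constructor
    · intro hx
      by_contra hxE
      obtain ⟨Q, hQ, hxQ⟩ := exists_mem_complComps hxE
      exact hx ⟨Q, hF ▸ Or.inl ⟨hQ, fun h => hxK (h hxQ)⟩, hxQ⟩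
    · exact fun hx => hE.subset_compl_sUnion hlevel hx

/-- Stages before `m` are left alone, since `K` is a component only from level `m`; from then on the
components inside `K` are replaced by the approximate ones. -/
theorem IsExhaustion.exists_refinement {m : ℕ} {K : Set RSphere} (hK : K ∈ complComps (E m))
    {ε : ℕ → Set RSphere → ℝ} (hε : ∀ j q, 0 < ε j q) (hanti : ∀ j q, ε (j + 1) q ≤ ε j q) :
    ∃ Dp : ℕ → Set RSphere, IsExhaustion D Dp ∧ IsRefinement Dp E ∧
      (∀ j, Dp j \ K = E j \ K) ∧
      ∀ j, m ≤ j → ∀ Q ∈ complComps (Dp j), Q ⊆ K → IsApprox D (ε j) Q := by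
  have hex : ∀ j, ∃ lev : Set RSphere → ℕ, ∀ q ∈ complComps D, j ≤ lev q ∧
      IsApprox D (ε j) (compOver (E (lev q)) q) ∧
      ∀ k', j ≤ k' → IsApprox D (ε j) (compOver (E k') q) → lev q ≤ k' := by
    intro j
    choose! lev h using fun q (hq : q ∈ complComps D) => hE.exists_level (hε j) j hq
    exact ⟨lev, h⟩
  choose lev hlev using hex
  set F : ℕ → Set (Set RSphere) := fun j => {Q | Q ∈ complComps (E j) ∧ ¬ Q ⊆ K} ∪
      {Q | ∃ q ∈ complComps D, q ⊆ K ∧ Q = compOver (E (lev j q)) q} with hF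
  have hfam := fun j (hmj : m ≤ j) => hE.refined_family hK hmj (hlev j) (F := F j) rfl
  set Dp : ℕ → Set RSphere := fun j => if m ≤ j then (⋃₀ F j)ᶜ else E j with hDp
  have hDp1 : ∀ j, m ≤ j → Dp j = (⋃₀ F j)ᶜ := fun j hj => by simp [hDp, hj]
  have hDp2 : ∀ j, ¬ m ≤ j → Dp j = E j := fun j hj => by simp [hDp, hj]
  have hle : ∀ j, E j ⊆ Dp j := by
    intro j
    by_cases hj : m ≤ j
    · rw [hDp1 j hj]
      exact hE.subset_compl_sUnion (hfam j hj).1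
    · rw [hDp2 j hj]
  have hsub : ∀ j, Dp j ⊆ D := by
    intro j
    by_cases hj : m ≤ j
    · rw [hDp1 j hj]
      exact compl_subset_comm.1 (hfam j hj).2.2.2.1
    · rw [hDp2 j hj]
      exact hE.subset j
  have hcomps : ∀ j, m ≤ j → complComps (Dp j) = F j := by
    intro j hj
    obtain ⟨h1, h2, h3, -⟩ := hfam j hj
    rw [hDp1 j hj]
    exact hE.complComps_compl_sUnion h1 h3 h2
  refine ⟨Dp, ⟨?_, hsub, ?_, ?_, ?_⟩, ?_, ?_, ?_⟩
  · intro j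
    by_cases hj : m ≤ j
    · rw [hDp1 j hj]
      exact hE.isDom_compl_sUnion (hfam j hj).1 (hfam j hj).2.2.1
    · rw [hDp2 j hj]
      exact hE.isDom j
  · intro j
    by_cases hj : m ≤ j
    · rw [hDp1 j hj]
      exact hE.jordan_compl_sUnion (hfam j hj).1 (hfam j hj).2.2.1 (hfam j hj).2.1
    · rw [hDp2 j hj]
      exact hE.bounded_by_jordan j
  · intro j
    by_cases hj : m ≤ j
    · rw [hDp1 j hj, hDp1 (j + 1) (by omega), compl_subset_compl]
      rintro x ⟨Q, hQ, hxQ⟩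
      rcases hQ with ⟨hQ, hQK⟩ | ⟨q, hq, hqK, rfl⟩
      · obtain ⟨R, hR, hxR⟩ := exists_mem_complComps (G := E j) fun h =>
          complComps_subset hQ hxQ (hE.mono j h)
        have hQR := hE.nested (Nat.le_succ j) hR hQ ⟨x, hxR, hxQ⟩
        exact ⟨R, Or.inl ⟨hR, fun h => hQK (hQR.trans h)⟩, hxR⟩
      · refine ⟨_, Or.inr ⟨q, hq, hqK, rfl⟩, hE.compOver_anti ?_ hq hxQ⟩
        -- What is approximate with the errors of stage `j + 1` is so with the larger errors of
        -- stage `j`; hence the chosen levels increase with the stage, and the sets shrink.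
        obtain ⟨h1, h2, -⟩ := hlev (j + 1) q hq
        exact (hlev j q hq).2.2 _ (by omega) (h2.mono (hanti j))
    · rw [hDp2 j hj]
      exact (hE.mono j).trans (hle _)
  · exact Subset.antisymm (iUnion_subset hsub)
      (hE.iUnion_eq ▸ iUnion_mono hle)
  · intro j Q hQ
    by_cases hj : m ≤ j
    · rw [hcomps j hj] at hQ
      exact (hfam j hj).1 Q hQ
    · rw [hDp2 j hj] at hQ
      exact ⟨j, le_rfl, hQ⟩
  · intro j
    by_cases hj : m ≤ j
    · rw [hDp1 j hj]
      exact (hfam j hj).2.2.2.2.2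
    · rw [hDp2 j hj]
  · intro j hj Q hQ hQK
    rw [hcomps j hj] at hQ
    exact (hfam j hj).2.2.2.2.1 Q hQ hQK

end Construction

/-! ### The quotient space -/

section Quotient

variable {G : Set RSphere}

theorem isQuotientMap_proj (G : Set RSphere) : IsQuotientMap (proj G) :=
  ⟨⟨rfl⟩, Quotient.mk_surjective⟩

theorem proj_eq_proj {x y : RSphere} :
    proj G x = proj G y ↔ x = y ∨ ∃ q ∈ complComps G, x ∈ q ∧ y ∈ q :=
  Quotient.eq (r := collapse G)

theorem proj_rep (w : Hat G) : proj G (rep G w) = w := Quotient.out_eq w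

theorem preimage_proj_of_mem {x : RSphere} (hx : x ∈ G) : proj G ⁻¹' {proj G x} = {x} := by
  ext y
  simp only [mem_preimage, mem_singleton_iff, proj_eq_proj]
  refine ⟨?_, Or.inl⟩
  rintro (h | ⟨q, hq, -, hxq⟩)
  · exact h
  · exact (complComps_subset hq hxq hx).elim

theorem preimage_proj_of_mem_comp {x : RSphere} {q : Set RSphere} (hq : q ∈ complComps G)
    (hx : x ∈ q) : proj G ⁻¹' {proj G x} = q := by
  ext y
  simp only [mem_preimage, mem_singleton_iff, proj_eq_proj]
  constructor
  · rintro (h | ⟨q', hq', hy, hxq'⟩)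
    · exact h ▸ hx
    · exact complComps_eq_of_mem hq' hq hxq' hx ▸ hy
  · exact fun hy => Or.inr ⟨q, hq, hy, hx⟩

theorem preimage_proj_mem_complComps {w : Hat G} (hw : w ∈ compPts G) :
    proj G ⁻¹' {w} ∈ complComps G := by
  obtain ⟨x, hx, rfl⟩ := hw
  obtain ⟨q, hq, hxq⟩ := exists_mem_complComps hx
  rwa [preimage_proj_of_mem_comp hq hxq]

theorem preimage_proj_injective (G : Set RSphere) :
    Function.Injective fun w : Hat G => proj G ⁻¹' {w} := fun v w h => by
  obtain ⟨x, rfl⟩ := (isQuotientMap_proj G).surjective v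
  have hx : x ∈ proj G ⁻¹' {proj G x} := rfl
  rw [show proj G ⁻¹' {proj G x} = proj G ⁻¹' {w} from h] at hx
  exact hx

theorem preimage_image_proj {A : Set RSphere} (hA : A ⊆ G) : proj G ⁻¹' (proj G '' A) = A := by
  refine Subset.antisymm ?_ (subset_preimage_image _ _)
  rintro y ⟨x, hx, hxy⟩
  have : y ∈ proj G ⁻¹' {proj G x} := hxy.symm
  rw [preimage_proj_of_mem (hA hx)] at this
  exact this ▸ hx

theorem isOpen_image_proj {A : Set RSphere} (hA : IsOpen A) (hAG : A ⊆ G) :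
    IsOpen (proj G '' A) := by
  rw [← (isQuotientMap_proj G).isOpen_preimage, preimage_image_proj hAG]
  exact hA

theorem compPts_eq_compl : compPts G = (proj G '' G)ᶜ := by
  ext w
  obtain ⟨x, rfl⟩ := (isQuotientMap_proj G).surjective w
  have h1 : proj G x ∈ proj G '' G ↔ x ∈ G := by
    rw [← mem_preimage, preimage_image_proj Subset.rfl]
  rw [mem_compl_iff, h1]
  constructor
  · rintro ⟨y, hy, hyx⟩ hx
    have : y ∈ proj G ⁻¹' {proj G x} := hyx
    rw [preimage_proj_of_mem hx] at this
    exact hy (this ▸ hx)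
  · exact fun hx => ⟨x, hx, rfl⟩

theorem finite_compPts (hfin : (complComps G).Finite) : (compPts G).Finite :=
  Set.Finite.of_finite_image (hfin.subset (by
    rintro _ ⟨w, hw, rfl⟩
    exact preimage_proj_mem_complComps hw)) (preimage_proj_injective G).injOn

theorem isPreconnected_preimage_proj (w : Hat G) : IsPreconnected (proj G ⁻¹' {w}) := by
  obtain ⟨x, rfl⟩ := (isQuotientMap_proj G).surjective w
  by_cases hx : x ∈ G
  · rw [preimage_proj_of_mem hx]
    exact isPreconnected_singleton
  · exact complComps_isPreconnected (preimage_proj_mem_complComps ⟨x, hx, rfl⟩)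

theorem isClosed_singleton_hat (hG : IsOpen G) (w : Hat G) : IsClosed ({w} : Set (Hat G)) := by
  rw [← (isQuotientMap_proj G).isClosed_preimage]
  obtain ⟨x, rfl⟩ := (isQuotientMap_proj G).surjective w
  by_cases hx : x ∈ G
  · rw [preimage_proj_of_mem hx]
    exact isClosed_singleton
  · exact complComps_isClosed hG (preimage_proj_mem_complComps ⟨x, hx, rfl⟩)

/-- Upper semicontinuity of the decomposition: upstairs the set is `O` with the finitely many closed
components not contained in `O` removed. -/
theorem isOpen_fibres_subset (hG : IsOpen G) (hfin : (complComps G).Finite) {O : Set RSphere}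
    (hO : IsOpen O) : IsOpen {w : Hat G | proj G ⁻¹' {w} ⊆ O} := by
  rw [← (isQuotientMap_proj G).isOpen_preimage]
  have : proj G ⁻¹' {w : Hat G | proj G ⁻¹' {w} ⊆ O} =
      O ∩ (⋃₀ {q ∈ complComps G | ¬ q ⊆ O})ᶜ := by
    ext x
    simp only [mem_preimage, mem_ofPred_eq, mem_inter_iff, mem_compl_iff, mem_sUnion, not_exists]
    constructor
    · intro h
      refine ⟨h rfl, ?_⟩
      rintro q ⟨⟨hq, hqO⟩, hxq⟩
      rw [preimage_proj_of_mem_comp hq hxq] at h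
      exact hqO h
    · rintro ⟨hxO, h⟩
      by_cases hx : x ∈ G
      · rw [preimage_proj_of_mem hx]
        exact singleton_subset_iff.2 hxO
      · by_contra hn
        exact h _ ⟨⟨preimage_proj_mem_complComps ⟨x, hx, rfl⟩, hn⟩, rfl⟩
  rw [this]
  exact hO.inter (isClosed_sUnion_of_finite (hfin.subset fun q hq => hq.1)
    fun q hq => complComps_isClosed hG hq.1).isOpen_compl

/-- An intermediate value theorem for a function that does not descend to the quotient. If the level
is missed, each fibre over the path, being connected, lies strictly on one side of it, and the two
sides disconnect the path. -/
theorem exists_level_of_path (hG : IsOpen G) (hfin : (complComps G).Finite) (γ : C(I, Hat G))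
    {d : RSphere → ℝ} (hd : Continuous d) {x₀ x₁ : RSphere} (h₀ : γ 0 = proj G x₀)
    (h₁ : γ 1 = proj G x₁) {τ : ℝ} (hτ₀ : d x₀ < τ) (hτ₁ : τ < d x₁) :
    ∃ y, proj G y ∈ range γ ∧ d y = τ := by
  by_contra! hne
  have hlt : IsOpen {x | d x < τ} := isOpen_lt hd continuous_const
  have hgt : IsOpen {x | τ < d x} := isOpen_lt continuous_const hd
  have hdis : Disjoint {x | d x < τ} {x | τ < d x} :=
    disjoint_left.2 fun x (h : d x < τ) (h' : τ < d x) => lt_asymm h h'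
  have hfib : ∀ w ∈ range γ, proj G ⁻¹' {w} ⊆ {x | d x < τ} ∨ proj G ⁻¹' {w} ⊆ {x | τ < d x} := by
    intro w hw
    refine (isPreconnected_preimage_proj w).subset_or_subset hlt hgt hdis fun y hy => ?_
    exact lt_or_gt_of_ne (hne y ((hy : proj G y = w) ▸ hw))
  obtain ⟨w, -, hw1, hw2⟩ := isPreconnected_range γ.continuous _ _
    (isOpen_fibres_subset hG hfin hlt) (isOpen_fibres_subset hG hfin hgt) hfib
    ⟨γ 0, mem_range_self 0, (hfib _ (mem_range_self 0)).resolve_right fun h =>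
      lt_asymm hτ₀ (h h₀.symm)⟩
    ⟨γ 1, mem_range_self 1, (hfib _ (mem_range_self 1)).resolve_left fun h =>
      lt_asymm hτ₁ (h h₁.symm)⟩
  obtain ⟨x, rfl⟩ := (isQuotientMap_proj G).surjective w
  exact disjoint_left.1 hdis (hw1 rfl) (hw2 rfl)

theorem isOpen_paramsIn (hG : IsOpen G) (γ : C(I, Hat G)) : IsOpen (paramsIn G γ) :=
  (isOpen_image_proj hG Subset.rfl).preimage γ.continuous

theorem rep_mem_of_mem_paramsIn {γ : C(I, Hat G)} {t : I} (ht : t ∈ paramsIn G γ) :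
    rep G (γ t) ∈ G := by
  obtain ⟨x, hx, hxt⟩ := ht
  rw [← hxt, rep_proj hx]
  exact hx

theorem continuousOn_rep (hG : IsOpen G) (γ : C(I, Hat G)) :
    ContinuousOn (fun t => rep G (γ t)) (paramsIn G γ) := by
  intro t ht
  refine ContinuousAt.continuousWithinAt ?_
  refine tendsto_nhds.2 fun O hO hrO => ?_
  have hopen : IsOpen (γ ⁻¹' (proj G '' (O ∩ G))) :=
    (isOpen_image_proj (hO.inter hG) inter_subset_right).preimage γ.continuous
  refine mem_of_superset (hopen.mem_nhds ⟨rep G (γ t), ⟨hrO, rep_mem_of_mem_paramsIn ht⟩,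
    proj_rep _⟩) ?_
  rintro s ⟨x, ⟨hxO, hxG⟩, hxs⟩
  change rep G (γ s) ∈ O
  rw [← hxs, rep_proj hxG]
  exact hxO

end Quotient

/-! ### Lower bounds for path integrals of radial densities -/

section PathBound

instance : LocallyConnectedSpace I :=
  locallyConnectedSpace_of_connected_bases (fun (t : I) (r : ℝ) => Metric.ball t r)
    (fun _ r => 0 < r) (fun t => Metric.nhds_basis_ball) fun t r _ => by
      have h : (Metric.ball t r).OrdConnected := ⟨fun x hx y hy z hz => by
        rw [Metric.mem_ball, Subtype.dist_eq, Real.dist_eq, abs_lt] at hx hy ⊢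
        have h1 : (x : ℝ) ≤ z := hz.1
        have h2 : (z : ℝ) ≤ y := hz.2
        constructor <;> linarith⟩
      exact h.isPreconnected

/-- Lebesgue measure on the line is one-dimensional Hausdorff measure, so no measurability of `B` is
required. -/
theorem volume_image_le_of_contracting {B : Set ℝ} {φ : ℝ → ℝ}
    (h : ∀ v ∈ B, ∀ w ∈ B, |φ v - φ w| ≤ |v - w|) : volume (φ '' B) ≤ volume B := by
  have hl : LipschitzOnWith 1 φ B := LipschitzOnWith.of_dist_le_mul fun v hv w hw => by
    simpa [Real.dist_eq] using h v hv w hw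
  have := hl.hausdorffMeasure_image_le (d := 1) zero_le_one
  simpa [hausdorffMeasure_real] using this

variable {ι : Type*} (s : Finset ι) (c : ι → ℝ≥0∞) (A : ι → Set ℝ)

/-- The step function `∑ i ∈ s, c i * 1_{A i}`. -/
noncomputable def stepFun (τ : ℝ) : ℝ≥0∞ := ∑ i ∈ s, (A i).indicator (fun _ => c i) τ

/-- The measure with density `stepFun s c A`. -/
noncomputable def stepMeasure : Measure ℝ := ∑ i ∈ s, c i • (volume : Measure ℝ).restrict (A i)

variable {s c A}

theorem stepMeasure_apply (hA : ∀ i ∈ s, IsOpen (A i)) (B : Set ℝ) :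
    stepMeasure s c A B = ∑ i ∈ s, c i * volume (B ∩ A i) := by
  rw [stepMeasure, Measure.finsetSum_apply]
  refine Finset.sum_congr rfl fun i hi => ?_
  rw [Measure.smul_apply, Measure.restrict_apply' (hA i hi).measurableSet, smul_eq_mul]

variable {d : RSphere → ℝ} (hd : LipschitzWith 1 d) (hA : ∀ i ∈ s, IsOpen (A i))
include hd hA

/-- As a function of arc length, `d ∘ f` is 1-Lipschitz. So the arc length spent where `d ∘ f` lies
in `A i` is at least the measure of the part of its image in `A i`. -/
theorem stepMeasure_le_arcIntegral {f : I → RSphere} {a b : I} (hab : a ≤ b)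
    (hf : ContinuousOn f (Icc a b)) {g : RSphere → ℝ≥0∞}
    (hg : ∀ t ∈ Icc a b, stepFun s c A (d (f t)) ≤ g (f t)) :
    stepMeasure s c A (d ∘ f '' Icc a b) ≤ arcIntegral f g a b := by
  classical
  unfold arcIntegral
  split_ifs with hvar
  · exact le_top
  have hbv : BoundedVariationOn f (Icc a b) := hvar
  have hlbv := hbv.locallyBoundedVariationOn
  have ha : a ∈ Icc a b := left_mem_Icc.2 hab
  set V := variationOnFromTo f (Icc a b) a with hV
  set P := naturalParameterization f (Icc a b) a with hP
  have hPV : ∀ t ∈ Icc a b, P (V t) = f t := fun t ht => by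
    have := edist_naturalParameterization_eq_zero hlbv ha ht
    exact edist_eq_zero.1 this
  have hVmono : MonotoneOn V (Icc a b) := variationOnFromTo.monotoneOn hlbv ha
  have hVle : ∀ t ∈ Icc a b, ∀ u ∈ Icc a b, t ≤ u → dist (f t) (f u) ≤ V u - V t := by
    intro t ht u hu htu
    rw [hV, variationOnFromTo.sub_right hlbv ha hu ht, variationOnFromTo.eq_of_le _ _ htu,
      dist_edist]
    exact ENNReal.toReal_mono (hlbv t u ht hu)
      (eVariationOn.edist_le f ⟨ht, left_mem_Icc.2 htu⟩ ⟨hu, right_mem_Icc.2 htu⟩)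
  have hVabs : ∀ t ∈ Icc a b, ∀ u ∈ Icc a b, |d (f t) - d (f u)| ≤ |V t - V u| := by
    intro t ht u hu
    have h1 : |d (f t) - d (f u)| ≤ dist (f t) (f u) := by
      simpa [Real.dist_eq] using hd.dist_le_mul (f t) (f u)
    refine h1.trans ?_
    rcases le_total t u with h | h
    · rw [abs_sub_comm]
      exact (hVle t ht u hu h).trans (le_abs_self _)
    · rw [dist_comm]
      exact (hVle u hu t ht h).trans (le_abs_self _)
  have hVmem : ∀ t ∈ Icc a b, V t ∈ Icc (0 : ℝ) (eVariationOn f (Icc a b)).toReal := by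
    intro t ht
    refine ⟨variationOnFromTo.nonneg_of_le _ _ ht.1, ?_⟩
    rw [hV, variationOnFromTo.eq_of_le _ _ ht.1]
    exact ENNReal.toReal_mono hvar (eVariationOn.mono f inter_subset_left)
  set T : ι → Set I := fun i => {t ∈ Icc a b | d (f t) ∈ A i} with hT
  have hTmeas : ∀ i ∈ s, MeasurableSet (V '' T i) := by
    intro i hi
    have hTm : MeasurableSet (T i) := by
      obtain ⟨u, hu, hu'⟩ := continuousOn_iff'.1 (hd.continuous.comp_continuousOn hf) _ (hA i hi)
      have : T i = u ∩ Icc a b := by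
        rw [← hu']
        ext t
        exact and_comm
      rw [this]
      exact hu.measurableSet.inter measurableSet_Icc
    -- Arc length is monotone but need not be injective; monotonicity suffices for the image to be
    -- measurable.
    exact hTm.image_of_monotoneOn (hVmono.mono fun t ht => ht.1)
  have hvol : ∀ i ∈ s, volume ((d ∘ f '' Icc a b) ∩ A i) ≤ volume (V '' T i) := by
    intro i hi
    have himg : (d ∘ f '' Icc a b) ∩ A i = (fun v => d (P v)) '' (V '' T i) := by
      ext τ
      constructor
      · rintro ⟨⟨t, ht, rfl⟩, hτ⟩
        exact ⟨V t, ⟨t, ⟨ht, hτ⟩, rfl⟩, by simp [hPV t ht]⟩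
      · rintro ⟨_, ⟨t, ⟨ht, hτ⟩, rfl⟩, rfl⟩
        simp only [hPV t ht]
        exact ⟨⟨t, ht, rfl⟩, hτ⟩
    rw [himg]
    refine volume_image_le_of_contracting ?_
    rintro _ ⟨t, ⟨ht, -⟩, rfl⟩ _ ⟨u, ⟨hu, -⟩, rfl⟩
    rw [hPV t ht, hPV u hu]
    exact hVabs t ht u hu
  rw [stepMeasure_apply hA]
  calc ∑ i ∈ s, c i * volume ((d ∘ f '' Icc a b) ∩ A i)
      ≤ ∑ i ∈ s, c i * volume (V '' T i) :=
        Finset.sum_le_sum fun i hi => mul_le_mul_right (hvol i hi) _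
    _ = ∑ i ∈ s, ∫⁻ v in Icc (0 : ℝ) (eVariationOn f (Icc a b)).toReal,
          (V '' T i).indicator (fun _ => c i) v := by
        refine Finset.sum_congr rfl fun i hi => ?_
        rw [lintegral_indicator (hTmeas i hi), setLIntegral_const,
          Measure.restrict_apply (hTmeas i hi), inter_eq_left.2]
        rintro _ ⟨t, ⟨ht, -⟩, rfl⟩
        exact hVmem t ht
    _ = ∫⁻ v in Icc (0 : ℝ) (eVariationOn f (Icc a b)).toReal,
          ∑ i ∈ s, (V '' T i).indicator (fun _ => c i) v := by
        rw [lintegral_finsetSum' _ fun i hi =>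
          (measurable_const.indicator (hTmeas i hi)).aemeasurable]
    _ ≤ ∫⁻ v in Icc (0 : ℝ) (eVariationOn f (Icc a b)).toReal, g (P v) := by
        refine lintegral_mono fun v => ?_
        by_cases hv : v ∈ V '' Icc a b
        · obtain ⟨t, ht, rfl⟩ := hv
          simp only
          rw [hPV t ht]
          refine le_trans (Finset.sum_le_sum fun i hi => ?_) (hg t ht)
          -- Parameters with the same arc length have the same image under `f`, so membership of `d
          -- (f t)` in `A i` depends only on `V t`.
          by_cases hVt : V t ∈ V '' T i
          · obtain ⟨u, ⟨hu, hu'⟩, huv⟩ := hVt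
            have : d (f t) ∈ A i := by rwa [← hPV t ht, ← huv, hPV u hu]
            rw [indicator_of_mem this, indicator_of_mem (show V t ∈ V '' T i from ⟨u, ⟨hu, hu'⟩, huv⟩)]
          · rw [indicator_of_notMem hVt]
            exact zero_le
        · have : ∑ i ∈ s, (V '' T i).indicator (fun _ => c i) v = 0 :=
            Finset.sum_eq_zero fun i hi => indicator_of_notMem
              (show v ∉ V '' T i from fun ⟨u, hu, huv⟩ => hv ⟨u, hu.1, huv⟩) _
          simp only [this]
          exact zero_le

/-- Continuity of measure from below: the open interval is an increasing union of compact sets, each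
contained in a closed subinterval spanned by its least and greatest elements. -/
theorem stepMeasure_le_intervalArcIntegral {f : I → RSphere} {J : Set I} (hJ : IsOpen J)
    (hJc : J.OrdConnected) (hf : ContinuousOn f J) {g : RSphere → ℝ≥0∞}
    (hg : ∀ t ∈ J, stepFun s c A (d (f t)) ≤ g (f t)) :
    stepMeasure s c A (d ∘ f '' J) ≤ intervalArcIntegral f g J := by
  obtain ⟨K, hKc, hKJ, hKU, hKm⟩ := hJ.exists_iUnion_isClosed
  rw [← hKU, image_iUnion, Monotone.measure_iUnion (fun m n hmn => image_mono (hKm hmn)), hKU]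
  refine iSup_le fun n => ?_
  rcases (K n).eq_empty_or_nonempty with hne | hne
  · simp [hne]
  obtain ⟨a, haK, ha⟩ := (hKc n).isCompact.exists_isLeast hne
  obtain ⟨b, hbK, hb⟩ := (hKc n).isCompact.exists_isGreatest hne
  have hab : a ≤ b := ha hbK
  have hsub : Icc a b ⊆ J := hJc.out (hKJ n haK) (hKJ n hbK)
  calc stepMeasure s c A (d ∘ f '' K n) ≤ stepMeasure s c A (d ∘ f '' Icc a b) :=
        measure_mono (image_mono fun t ht => ⟨ha ht, hb ht⟩)
    _ ≤ arcIntegral f g a b := stepMeasure_le_arcIntegral hd hA hab (hf.mono hsub)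
        fun t ht => hg t (hsub ht)
    _ ≤ intervalArcIntegral f g J :=
        le_iSup_of_le a (le_iSup_of_le b (le_iSup_of_le hab (le_iSup_of_le hsub le_rfl)))

theorem stepMeasure_le_pathIntegral {G : Set RSphere} (hG : IsOpen G) (γ : C(I, Hat G))
    {ρ : Hat G → ℝ≥0∞} (hρ : ∀ x ∈ G, stepFun s c A (d x) ≤ ρ (proj G x)) :
    stepMeasure s c A ((fun t => d (rep G (γ t))) '' paramsIn G γ) ≤ pathIntegral G ρ γ := by
  set S : Set (Set I) := {J | ∃ t ∈ paramsIn G γ, J = connectedComponentIn (paramsIn G γ) t}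
    with hS
  have hopen := isOpen_paramsIn hG γ
  have hcount : S.Countable := by
    refine PairwiseDisjoint.countable_of_isOpen (s := id) ?_ ?_ ?_
    · rintro _ ⟨t, ht, rfl⟩ _ ⟨u, hu, rfl⟩ hne
      by_contra h
      obtain ⟨v, hv1, hv2⟩ := not_disjoint_iff.1 h
      exact hne (by rw [connectedComponentIn_eq hv1, connectedComponentIn_eq hv2])
    · rintro _ ⟨t, ht, rfl⟩
      exact hopen.connectedComponentIn
    · rintro _ ⟨t, ht, rfl⟩
      exact ⟨t, mem_connectedComponentIn ht⟩
  have : Countable S := hcount.to_subtype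
  have hcover : (fun t => d (rep G (γ t))) '' paramsIn G γ ⊆
      ⋃ J : S, (fun t => d (rep G (γ t))) '' J.1 := by
    rintro _ ⟨t, ht, rfl⟩
    exact mem_iUnion.2 ⟨⟨_, t, ht, rfl⟩, t, mem_connectedComponentIn ht, rfl⟩
  refine (measure_mono hcover).trans ((measure_iUnion_le _).trans ?_)
  refine ENNReal.tsum_le_tsum fun J => ?_
  obtain ⟨J, t, ht, rfl⟩ := J
  have hsub := connectedComponentIn_subset (paramsIn G γ) t
  refine stepMeasure_le_intervalArcIntegral (f := fun t => rep G (γ t)) hd hA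
    hopen.connectedComponentIn isPreconnected_connectedComponentIn.ordConnected
    ((continuousOn_rep hG γ).mono hsub) fun u hu => hρ _ (rep_mem_of_mem_paramsIn (hsub hu))

/-- Every path of the quotient that crosses the range `(α, β)` of the function `d` has length at
least the measure of that interval. -/
theorem stepMeasure_Ioo_le_length {G : Set RSphere} (hG : IsOpen G)
    (hfin : (complComps G).Finite) (γ : C(I, Hat G)) {ρ : Hat G → ℝ≥0∞}
    (hρ : ∀ x ∈ G, stepFun s c A (d x) ≤ ρ (proj G x))
    (hρ' : ∀ w ∈ compPts G ∩ range γ, stepMeasure s c A (d '' (proj G ⁻¹' {w})) ≤ ρ w)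
    {x₀ x₁ : RSphere} (h₀ : γ 0 = proj G x₀) (h₁ : γ 1 = proj G x₁) {α β : ℝ} (hα : d x₀ ≤ α)
    (hβ : β ≤ d x₁) :
    stepMeasure s c A (Ioo α β) ≤
      pathIntegral G ρ γ + ∑' w : (compPts G ∩ range γ : Set (Hat G)), ρ w := by
  have hcount : (compPts G ∩ range γ).Countable :=
    ((finite_compPts hfin).subset inter_subset_left).countable
  have : Countable (compPts G ∩ range γ : Set (Hat G)) := hcount.to_subtype
  -- Every intermediate level is attained on a fibre over the path: either at a point of `G`, or
  -- inside a collapsed component that the path meets.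
  have hcover : Ioo α β ⊆ ((fun t => d (rep G (γ t))) '' paramsIn G γ) ∪
      ⋃ w : (compPts G ∩ range γ : Set (Hat G)), d '' (proj G ⁻¹' {w.1}) := by
    rintro τ ⟨hτ₀, hτ₁⟩
    obtain ⟨y, ⟨t, hty⟩, rfl⟩ := exists_level_of_path hG hfin γ hd.continuous h₀ h₁
      (hα.trans_lt hτ₀) (hτ₁.trans_le hβ)
    by_cases hy : y ∈ G
    · refine Or.inl ⟨t, ⟨y, hy, hty.symm⟩, ?_⟩
      simp only [hty, rep_proj hy]
    · exact Or.inr (mem_iUnion.2 ⟨⟨proj G y, ⟨y, hy, rfl⟩, t, hty⟩, y, rfl, rfl⟩)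
  refine (measure_mono hcover).trans ((measure_union_le _ _).trans ?_)
  refine add_le_add (stepMeasure_le_pathIntegral hd hA hG γ hρ) ?_
  exact (measure_iUnion_le _).trans (ENNReal.tsum_le_tsum fun w => hρ' w.1 w.2)

end PathBound

/-! ### The area of spherical disks -/

section Area

local notation "E3" => EuclideanSpace ℝ (Fin 3)

theorem exists_orthonormalBasis_last (x : RSphere) :
    ∃ b : OrthonormalBasis (Fin 3) ℝ E3, b 2 = x := by
  have hx : ‖(x : E3)‖ = 1 := norm_eq_of_mem_sphere x
  have hv : Orthonormal ℝ (({2} : Set (Fin 3)).domRestrict fun _ => (x : E3)) := by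
    refine ⟨fun i => hx, fun i j hij => ?_⟩
    exact (hij (Subsingleton.elim i j)).elim
  obtain ⟨b, hb⟩ := hv.exists_orthonormalBasis_extension_of_card_eq (by simp)
  exact ⟨b, hb 2 rfl⟩

theorem volume_box (b : OrthonormalBasis (Fin 3) ℝ E3) {J : Fin 3 → Set ℝ}
    (hJ : ∀ i, MeasurableSet (J i)) :
    volume {v : E3 | ∀ i, inner ℝ (b i) v ∈ J i} = ∏ i, volume (J i) := by
  have h1 := b.measurePreserving_repr
  have h2 := PiLp.volume_preserving_ofLp (Fin 3)
  have h := h2.comp h1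
  rw [← volume_pi_pi, ← h.measure_preimage (MeasurableSet.univ_pi hJ).nullMeasurableSet]
  congr 1
  ext v
  simp [b.repr_apply_apply]

theorem area_apply {A : Set RSphere} (hA : MeasurableSet A) :
    area A = 3 * volume {v : E3 | ∃ r : ℝ, r ∈ Ioo (0 : ℝ) 1 ∧ ∃ y ∈ A, r • (y : E3) = v} := by
  rw [area, Measure.toSphere_apply' _ hA, finrank_euclideanSpace_fin]
  congr 2
  ext v
  simp only [Set.mem_smul, mem_image, exists_exists_and_eq_and, mem_ofPred_eq]

instance : IsFiniteMeasure area := by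
  unfold area
  infer_instance

/-- In orthonormal coordinates with last axis `x`, the cone over the disk lies in `[-t, t]² × [-1,
1]`, whose volume is `8 * t ^ 2`; surface area is three times the volume of the cone. -/
theorem area_closedBall_le (x : RSphere) {t : ℝ} (ht : 0 ≤ t) :
    area (Metric.closedBall x t) ≤ ENNReal.ofReal (24 * t ^ 2) := by
  obtain ⟨b, hb⟩ := exists_orthonormalBasis_last x
  rw [area_apply Metric.isClosed_closedBall.measurableSet]
  have hbox := volume_box b (J := ![Icc (-t) t, Icc (-t) t, Icc (-1) 1])
    (by intro i; fin_cases i <;> exact measurableSet_Icc)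
  rw [Fin.prod_univ_three] at hbox
  simp only [Matrix.cons_val_zero, Matrix.cons_val_one, Matrix.cons_val, Real.volume_Icc] at hbox
  refine (mul_le_mul_right (measure_mono ?_) 3).trans (le_of_eq ((congrArg (3 * ·) hbox).trans ?_))
  · rintro v ⟨r, ⟨hr0, hr1⟩, y, hy, rfl⟩ i
    have hyn : ‖(y : E3)‖ = 1 := norm_eq_of_mem_sphere y
    have hyx : ‖(y : E3) - x‖ ≤ t := by
      rw [← dist_eq_norm]; exact hy
    have hside : ∀ i : Fin 3, i ≠ 2 → inner ℝ (b i) (r • (y : E3)) ∈ Icc (-t) t := by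
      intro i hi
      have h0 : inner ℝ (b i) (x : E3) = 0 := by
        rw [← hb]; exact b.orthonormal.2 hi
      have h1 : inner ℝ (b i) (r • (y : E3)) = r * inner ℝ (b i) ((y : E3) - x) := by
        rw [inner_smul_right, inner_sub_right, h0, sub_zero]
      have h2 : |inner ℝ (b i) ((y : E3) - x)| ≤ t := by
        refine (abs_real_inner_le_norm _ _).trans ?_
        rw [b.orthonormal.1 i, one_mul]; exact hyx
      rw [h1, mem_Icc, ← abs_le, abs_mul, abs_of_pos hr0]
      nlinarith [abs_nonneg (inner ℝ (b i) ((y : E3) - x))]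
    fin_cases i
    · exact hside 0 (by decide)
    · exact hside 1 (by decide)
    · have h2 : |inner ℝ (b 2) (r • (y : E3))| ≤ 1 := by
        refine (abs_real_inner_le_norm _ _).trans ?_
        rw [b.orthonormal.1 2, one_mul, norm_smul, hyn, mul_one, Real.norm_of_nonneg hr0.le]
        exact hr1.le
      exact abs_le.1 h2
  · have h3 : (3 : ℝ≥0∞) = ENNReal.ofReal 3 := by simp
    simp only [h3]
    rw [← ENNReal.ofReal_mul (by linarith), ← ENNReal.ofReal_mul (by nlinarith),
      ← ENNReal.ofReal_mul (by norm_num)]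
    congr 1
    ring

/-- The cone over the disk contains the box `[-t/8, t/8]² × [1/2, 2/3]`: its points are within `t /
4` of their projection to the axis, at height at least `1 / 2`, so normalizing them lands within `t`
of `x`. -/
theorem le_area_closedBall (x : RSphere) {t : ℝ} (ht : 0 ≤ t) (ht1 : t ≤ 1) :
    ENNReal.ofReal (t ^ 2 / 32) ≤ area (Metric.closedBall x t) := by
  obtain ⟨b, hb⟩ := exists_orthonormalBasis_last x
  rw [area_apply Metric.isClosed_closedBall.measurableSet]
  have hbox := volume_box b (J := ![Icc (-(t / 8)) (t / 8), Icc (-(t / 8)) (t / 8), Icc (1 / 2) (2 / 3)])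
    (by intro i; fin_cases i <;> exact measurableSet_Icc)
  rw [Fin.prod_univ_three] at hbox
  simp only [Matrix.cons_val_zero, Matrix.cons_val_one, Matrix.cons_val, Real.volume_Icc] at hbox
  refine le_trans (le_of_eq (Eq.trans ?_ (congrArg (3 * ·) hbox).symm))
    (mul_le_mul_right (measure_mono ?_) 3)
  · have h3 : (3 : ℝ≥0∞) = ENNReal.ofReal 3 := by simp
    simp only [h3]
    rw [← ENNReal.ofReal_mul (by linarith), ← ENNReal.ofReal_mul (by nlinarith),
      ← ENNReal.ofReal_mul (by norm_num)]
    congr 1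
    ring
  · intro v hv
    have h0 : inner ℝ (b 0) v ∈ Icc (-(t / 8)) (t / 8) := hv 0
    have h1 : inner ℝ (b 1) v ∈ Icc (-(t / 8)) (t / 8) := hv 1
    have h2 : inner ℝ (b 2) v ∈ Icc (1 / 2 : ℝ) (2 / 3) := hv 2
    set a₀ := inner ℝ (b 0) v
    set a₁ := inner ℝ (b 1) v
    set c := inner ℝ (b 2) v
    have hsum : v = a₀ • b 0 + a₁ • b 1 + c • (x : E3) := by
      rw [← hb]
      have := b.sum_repr' v
      rw [Fin.sum_univ_three] at this
      exact this.symm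
    have hc : 0 < c := by linarith [h2.1]
    have hdiff : ‖v - c • (x : E3)‖ ≤ t / 4 := by
      have : v - c • (x : E3) = a₀ • b 0 + a₁ • b 1 := by
        rw [sub_eq_iff_eq_add]; exact hsum
      rw [this]
      refine (norm_add_le _ _).trans ?_
      rw [norm_smul, norm_smul, b.orthonormal.1, b.orthonormal.1, Real.norm_eq_abs,
        Real.norm_eq_abs]
      linarith [abs_le.2 h0, abs_le.2 h1]
    have hxn : ‖(x : E3)‖ = 1 := norm_eq_of_mem_sphere x
    have hcx : ‖c • (x : E3)‖ = c := by rw [norm_smul, hxn, mul_one, Real.norm_of_nonneg hc.le]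
    have hnorm : |‖v‖ - c| ≤ t / 4 := by
      have := abs_norm_sub_norm_le v (c • (x : E3))
      rw [hcx] at this
      exact this.trans hdiff
    have hvpos : 0 < ‖v‖ := by
      have := (abs_le.1 hnorm).1
      linarith [h2.1]
    have hv1 : ‖v‖ < 1 := by
      have := (abs_le.1 hnorm).2
      linarith [h2.2]
    have hyn : ‖(‖v‖⁻¹ • v)‖ = 1 := by
      rw [norm_smul, norm_inv, norm_norm, inv_mul_cancel₀ hvpos.ne']
    refine ⟨‖v‖, ⟨hvpos, hv1⟩, ⟨‖v‖⁻¹ • v, by simpa using hyn⟩, ?_, ?_⟩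
    · change dist (‖v‖⁻¹ • v) (x : E3) ≤ t
      have hcv : c * ‖(‖v‖⁻¹ • v) - x‖ ≤ t / 2 := by
        have h4 : c • ((‖v‖⁻¹ • v) - (x : E3)) =
            (c - ‖v‖) • (‖v‖⁻¹ • v) + (v - c • (x : E3)) := by
          have : ‖v‖ • (‖v‖⁻¹ • v) = v := by
            rw [smul_smul, mul_inv_cancel₀ hvpos.ne', one_smul]
          rw [smul_sub, sub_smul, this]
          abel
        calc c * ‖(‖v‖⁻¹ • v) - x‖ = ‖c • ((‖v‖⁻¹ • v) - (x : E3))‖ := by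
              rw [norm_smul, Real.norm_of_nonneg hc.le]
          _ ≤ ‖(c - ‖v‖) • (‖v‖⁻¹ • v)‖ + ‖v - c • (x : E3)‖ := by
              rw [h4]; exact norm_add_le _ _
          _ ≤ t / 4 + t / 4 := by
              refine add_le_add ?_ hdiff
              rw [norm_smul, hyn, mul_one, Real.norm_eq_abs, abs_sub_comm]
              exact hnorm
          _ = t / 2 := by ring
      rw [dist_eq_norm]
      nlinarith [h2.1, norm_nonneg ((‖v‖⁻¹ • v) - (x : E3))]
    · change ‖v‖ • (‖v‖⁻¹ • v) = v
      rw [smul_smul, mul_inv_cancel₀ hvpos.ne', one_smul]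

/-- Near each of its points a spherical disk of radius at most one contains a disk of any smaller
radius, up to a factor. -/
theorem exists_subdisk {x y : RSphere} {r t : ℝ} (hr1 : r ≤ 1) (ht : 0 ≤ t)
    (htr : t ≤ r) (hy : dist y x ≤ r) :
    ∃ y', Metric.closedBall y' (t / 4) ⊆ Metric.closedBall x r ∩ Metric.closedBall y (2 * t) := by
  rcases ht.eq_or_lt with rfl | htpos
  · refine ⟨y, ?_⟩
    simp only [zero_div, mul_zero, Metric.closedBall_zero, singleton_subset_iff]
    exact ⟨hy, rfl⟩
  have hr : 0 < r := htpos.trans_le htr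
  -- The new centre is obtained by moving `y` the fraction `l` along the chord to `x`, then
  -- normalizing. It stays within `t` of `y`, while its squared distance to `x` is at most `(1 - l)
  -- * d ^ 2 ≤ ((1 - l / 2) * r) ^ 2 = (r - t / 4) ^ 2`.
  set l : ℝ := t / (2 * r) with hl
  have hl0 : 0 ≤ l := by positivity
  have hl1 : l ≤ 1 / 2 := by
    rw [hl, div_le_iff₀ (by positivity)]
    linarith
  have hlr : l * r = t / 2 := by
    rw [hl]; field_simp
  set X : E3 := x.1
  set Y : E3 := y.1
  have hX : ‖X‖ = 1 := norm_eq_of_mem_sphere x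
  have hY : ‖Y‖ = 1 := norm_eq_of_mem_sphere y
  set d := ‖Y - X‖ with hd
  have hdr : d ≤ r := by rw [hd, ← dist_eq_norm]; exact hy
  have hd0 : 0 ≤ d := norm_nonneg _
  set a : ℝ := inner ℝ Y X with ha
  have hd2 : d ^ 2 = 2 - 2 * a := by
    rw [hd, norm_sub_sq_real, hX, hY]; ring
  set v : E3 := Y + l • (X - Y) with hv
  have hvY : ‖v - Y‖ = l * d := by
    rw [hv, add_sub_cancel_left, norm_smul, Real.norm_of_nonneg hl0, hd, norm_sub_rev]
  have hld : l * d ≤ t / 2 := by nlinarith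
  have hld' : l * d ≤ 1 / 2 := by nlinarith
  have hvge : 1 - l * d ≤ ‖v‖ := by
    have := norm_sub_norm_le Y v
    rw [norm_sub_rev, hvY, hY] at this
    linarith
  have hvpos : 0 < ‖v‖ := by linarith
  have hvle : ‖v‖ ≤ 1 := by
    have h1 : v = (1 - l) • Y + l • X := by
      rw [hv, smul_sub, sub_smul, one_smul]; abel
    rw [h1]
    refine (norm_add_le _ _).trans ?_
    rw [norm_smul, norm_smul, hX, hY, Real.norm_of_nonneg hl0, Real.norm_of_nonneg (by linarith)]
    linarith
  have hinner : inner ℝ v X = a + l * (1 - a) := by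
    rw [hv, inner_add_left, inner_smul_left, inner_sub_left, real_inner_self_eq_norm_sq, hX]
    simp [ha]
  have hyn : ‖(‖v‖⁻¹ • v)‖ = 1 := by
    rw [norm_smul, norm_inv, norm_norm, inv_mul_cancel₀ hvpos.ne']
  have hinv : 1 ≤ ‖v‖⁻¹ := (one_le_inv₀ hvpos).2 hvle
  have hx' : ‖(‖v‖⁻¹ • v) - X‖ ≤ r - t / 4 := by
    have h1 : ‖(‖v‖⁻¹ • v) - X‖ ^ 2 ≤ (1 - l) * d ^ 2 := by
      rw [norm_sub_sq_real, hyn, hX, inner_smul_left, hinner, hd2]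
      have ha' : 0 ≤ a := by nlinarith
      have : 0 ≤ a + l * (1 - a) := by nlinarith
      simp only [conj_trivial]
      nlinarith
    have h2 : r - t / 4 = (1 - l / 2) * r := by linarith
    rw [h2]
    refine le_of_sq_le_sq ?_ (by nlinarith)
    nlinarith [sq_nonneg (l * r), mul_nonneg (sub_nonneg.2 (hl1.trans (by norm_num : (1 / 2 : ℝ) ≤ 1)))
      (by nlinarith : 0 ≤ r ^ 2 - d ^ 2)]
  have hy' : ‖(‖v‖⁻¹ • v) - Y‖ ≤ t := by
    have h1 : ‖(‖v‖⁻¹ • v) - v‖ ≤ l * d := by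
      have : (‖v‖⁻¹ • v) - v = (1 - ‖v‖) • (‖v‖⁻¹ • v) := by
        rw [sub_smul, one_smul, smul_smul ‖v‖, mul_inv_cancel₀ hvpos.ne', one_smul]
      rw [this, norm_smul, hyn, mul_one, Real.norm_of_nonneg (by linarith)]
      linarith
    have h2 := norm_sub_le_norm_sub_add_norm_sub (‖v‖⁻¹ • v) v Y
    rw [hvY] at h2
    linarith
  refine ⟨⟨‖v‖⁻¹ • v, by simpa using hyn⟩, fun w hw => ⟨?_, ?_⟩⟩
  · have h1 : dist (⟨‖v‖⁻¹ • v, by simpa using hyn⟩ : RSphere) x ≤ r - t / 4 := by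
      rw [Subtype.dist_eq, dist_eq_norm]; exact hx'
    have h2 := dist_triangle w (⟨‖v‖⁻¹ • v, by simpa using hyn⟩ : RSphere) x
    rw [Metric.mem_closedBall] at hw ⊢
    linarith
  · have h1 : dist (⟨‖v‖⁻¹ • v, by simpa using hyn⟩ : RSphere) y ≤ t := by
      rw [Subtype.dist_eq, dist_eq_norm]; exact hy'
    have h2 := dist_triangle w (⟨‖v‖⁻¹ • v, by simpa using hyn⟩ : RSphere) y
    rw [Metric.mem_closedBall] at hw ⊢
    linarith

theorem le_area_disk_inter {x y : RSphere} {r t : ℝ} (hr1 : r ≤ 1) (ht : 0 ≤ t)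
    (htr : t ≤ r) (hy : dist y x ≤ r) :
    ENNReal.ofReal (t ^ 2 / 512) ≤
      area (Metric.closedBall x r ∩ Metric.closedBall y (2 * t)) := by
  obtain ⟨y', h⟩ := exists_subdisk hr1 ht htr hy
  refine le_trans (le_of_eq ?_) ((le_area_closedBall y' (t := t / 4) (by linarith)
    (by linarith)).trans (measure_mono h))
  congr 1
  ring

/-- The given radius can be too large, as when the ball is the whole sphere; the greatest distance
to the centre that is attained serves instead. -/
theorem IsClosedDisk.exists_radius_le_diam {q : Set RSphere} (h : IsClosedDisk q) :
    ∃ x : RSphere, ∃ r : ℝ, 0 ≤ r ∧ q = Metric.closedBall x r ∧ r ≤ Metric.diam q := by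
  obtain ⟨x, r, hr, rfl⟩ := h
  have hcomp : IsCompact (Metric.closedBall x r) := Metric.isClosed_closedBall.isCompact
  obtain ⟨y, hy, hmax⟩ := hcomp.exists_isMaxOn ⟨x, Metric.mem_closedBall_self hr⟩
    (f := fun y => dist y x) (by fun_prop)
  refine ⟨x, dist y x, dist_nonneg, ?_,
    Metric.dist_le_diam_of_mem hcomp.isBounded hy (Metric.mem_closedBall_self hr)⟩
  refine Subset.antisymm (fun w hw => hmax hw) (Metric.closedBall_subset_closedBall hy)

end Area

/-! ### Components that are almost disks -/

/-- The set `Q` is a disk complementary to `D`, different from `p`, up to the error `ε`. -/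
def IsDiskLike (D p : Set RSphere) (ε : Set RSphere → ℝ) (Q : Set RSphere) : Prop :=
  ∃ q ∈ complComps D, q ≠ p ∧ q ⊆ Q ∧ Q ⊆ Metric.cthickening (ε q) q ∧
    ∃ x r, 0 ≤ r ∧ q = Metric.closedBall x r ∧ r ≤ Metric.diam q

theorem exists_near_of_mem_cthickening {q : Set RSphere} (hq : IsClosed q) {ε : ℝ}
    (hε : 0 ≤ ε) {w : RSphere} (hw : w ∈ Metric.cthickening ε q) : ∃ y ∈ q, dist w y ≤ ε := by
  rw [hq.isCompact.cthickening_eq_biUnion_closedBall hε] at hw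
  obtain ⟨y, hy, hwy⟩ := mem_iUnion₂.1 hw
  exact ⟨y, hy, hwy⟩

/-- The disks are disjoint, their areas are bounded below, and the sphere has finite area. -/
theorem finite_big_disks {D : Set RSphere} (hD : IsOpen D) {s : ℝ} (hs : 0 < s) :
    {q | q ∈ complComps D ∧ ∃ x r, s ≤ r ∧ q = Metric.closedBall x r}.Finite := by
  have hpos : 0 < ENNReal.ofReal ((min s 1) ^ 2 / 32) := by
    rw [ENNReal.ofReal_pos]; positivity
  have hfin := Measure.finite_const_le_meas_of_disjoint_iUnion area hpos
    (As := fun q : complComps D => q.1)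
    (fun q => (complComps_isClosed hD q.2).measurableSet)
    (fun q q' hne => by
      by_contra h
      obtain ⟨x, hx, hx'⟩ := not_disjoint_iff.1 h
      exact hne (Subtype.ext (complComps_eq_of_mem q.2 q'.2 hx hx')))
    (measure_ne_top _ _)
  refine (hfin.image Subtype.val).subset ?_
  rintro q ⟨hq, x, r, hr, hqx⟩
  refine ⟨⟨q, hq⟩, ?_, rfl⟩
  change ENNReal.ofReal ((min s 1) ^ 2 / 32) ≤ area q
  rw [hqx]
  refine (le_area_closedBall x (by positivity) (min_le_right _ _)).trans (measure_mono ?_)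
  exact Metric.closedBall_subset_closedBall ((min_le_left _ _).trans hr)

theorem sq_sum_le_of_unique_ne_zero {ι : Type*} (s : Finset ι) (f : ι → ℝ≥0∞)
    (h : ∀ i ∈ s, ∀ j ∈ s, i ≠ j → f i = 0 ∨ f j = 0) :
    (∑ i ∈ s, f i) ^ 2 = ∑ i ∈ s, f i ^ 2 := by
  rw [sq, Finset.sum_mul_sum]
  refine Finset.sum_congr rfl fun i hi => ?_
  rw [Finset.sum_eq_single i, sq]
  · intro j hj hji
    rcases h j hj i hi hji with h | h <;> simp [h]
  · exact fun h => (h hi).elim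

section Scales

variable {D p : Set RSphere} {E : ℕ → Set RSphere} {z : RSphere} {R : ℝ}
  {ε : ℕ → Set RSphere → ℝ} {δ : ℕ → ℝ}

/-- A component reaching from distance `s` almost to `z` has to be modelled on a large disk. There
are finitely many of those, and their union is closed and misses `z ∈ p`. -/
theorem exists_scale (hD : IsOpen D) (hp : p ∈ complComps D) (hz : z ∈ p) (hR : 0 < R)
    (hε : ∀ j q, 0 ≤ ε j q) (hεδ : ∀ j, ∀ q ∈ complComps D, ε j q ≤ δ j)
    (hδ : Tendsto δ atTop (𝓝 0))
    (hlike : ∀ᶠ j in atTop, ∀ Q ∈ complComps (E j), Q ≠ compOver (E j) p →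
      (Q ∩ Metric.ball z R).Nonempty → IsDiskLike D p (ε j) Q) {s : ℝ} (hs : 0 < s) :
    ∃ s', 0 < s' ∧ 2 * s' ≤ R ∧ s' ≤ s / 2 ∧
      ∀ᶠ j in atTop, ∀ Q ∈ complComps (E j), Q ≠ compOver (E j) p →
        ∀ x ∈ Q, s ≤ dist x z → ∀ y ∈ Q, 2 * s' ≤ dist y z := by
  -- With `2 * s' ≤ s / 4` and error below `s / 4`, a disk joining the two distances has diameter at
  -- least `s / 4`, whence the threshold `s / 8`. The number `κ` below then keeps these disks away
  -- from `z`.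
  set B := {q | q ∈ complComps D ∧ ∃ x r, s / 8 ≤ r ∧ q = Metric.closedBall x r} \ {p} with hB
  have hBfin : B.Finite := (finite_big_disks hD (s := s / 8) (by positivity)).subset sdiff_subset
  have hBcl : IsClosed (⋃₀ B) :=
    isClosed_sUnion_of_finite hBfin fun q hq => complComps_isClosed hD hq.1.1
  have hzB : z ∉ ⋃₀ B := fun ⟨q, hq, hzq⟩ => hq.2 (complComps_eq_of_mem hq.1.1 hp hzq hz)
  obtain ⟨κ, hκ, hκB⟩ := Metric.isOpen_iff.1 hBcl.isOpen_compl z hzB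
  refine ⟨min (min (s / 8) (κ / 4)) (R / 2), by positivity, ?_, ?_, ?_⟩
  · linarith [min_le_right (min (s / 8) (κ / 4)) (R / 2)]
  · linarith [(min_le_left (min (s / 8) (κ / 4)) (R / 2)).trans (min_le_left _ _)]
  have hδ' : ∀ᶠ j in atTop, δ j < min (s / 4) (κ / 2) :=
    hδ.eventually_lt_const (by positivity)
  filter_upwards [hlike, hδ'] with j hj hδj Q hQ hQp x hxQ hx y hyQ
  by_contra! hy
  have hm1 : min (min (s / 8) (κ / 4)) (R / 2) ≤ s / 8 := (min_le_left _ _).trans (min_le_left _ _)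
  have hm2 : min (min (s / 8) (κ / 4)) (R / 2) ≤ κ / 4 := (min_le_left _ _).trans (min_le_right _ _)
  have hm3 : min (min (s / 8) (κ / 4)) (R / 2) ≤ R / 2 := min_le_right _ _
  obtain ⟨q, hq, hqp, -, hQq, c, r, hr, hqc, -⟩ := hj Q hQ hQp
    ⟨y, hyQ, by rw [Metric.mem_ball]; linarith⟩
  have hqcl := complComps_isClosed hD hq
  have hεq : ε j q < min (s / 4) (κ / 2) := (hεδ j q hq).trans_lt hδj
  have hε1 : ε j q < s / 4 := hεq.trans_le (min_le_left _ _)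
  have hε2 : ε j q < κ / 2 := hεq.trans_le (min_le_right _ _)
  obtain ⟨x', hx'q, hx'⟩ := exists_near_of_mem_cthickening hqcl (hε j q) (hQq hxQ)
  obtain ⟨y', hy'q, hy'⟩ := exists_near_of_mem_cthickening hqcl (hε j q) (hQq hyQ)
  have hxc : dist x' c ≤ r := by rw [hqc] at hx'q; exact hx'q
  have hyc : dist y' c ≤ r := by rw [hqc] at hy'q; exact hy'q
  have h1 : s / 8 ≤ r := by
    have t1 := dist_triangle x x' z
    have t2 := dist_triangle x' c z
    have t3 := dist_triangle c y' z
    have t4 := dist_triangle y' y z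
    rw [dist_comm c y'] at t3
    rw [dist_comm y' y] at t4
    linarith
  have hqB : q ∈ B := ⟨⟨hq, c, r, h1, hqc⟩, hqp⟩
  have hyz := dist_triangle y' y z
  rw [dist_comm y' y] at hyz
  have hball : y' ∈ Metric.ball z κ := by
    rw [Metric.mem_ball]
    linarith
  exact hκB hball ⟨q, hqB, hy'q⟩

/-- The atoms contributed to the total mass by a single annulus. -/
theorem sum_sq_volume_le {G : Set RSphere} {ε : Set RSphere → ℝ} {s : ℝ} (hs : 0 < s)
    (hD : IsOpen D) (hε : ∀ q, 0 ≤ ε q) (hεs : ∀ q ∈ complComps D, ε q ≤ s)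
    (hε1 : ∀ q ∈ complComps D, ε q ≤ 1)
    (hsum : ∑' q : complComps D, ENNReal.ofReal (ε q) ≤ ENNReal.ofReal (s ^ 2))
    {P : Hat G} (hlike : ∀ w ∈ compPts G, w ≠ P →
      ((proj G ⁻¹' {w}) ∩ Metric.ball z (2 * s)).Nonempty →
        proj G ⁻¹' {w} ⊆ Metric.ball z (1 / 2) ∧ IsDiskLike D p ε (proj G ⁻¹' {w})) :
    ∑' w : (compPts G \ {P} : Set (Hat G)),
      volume (((fun x => dist x z) '' (proj G ⁻¹' {w.1})) ∩ Ioo s (2 * s)) ^ 2 ≤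
        ENNReal.ofReal (2500000 * s ^ 2) := by
  set f : Hat G → ℝ≥0∞ := fun w =>
    volume (((fun x => dist x z) '' (proj G ⁻¹' {w})) ∩ Ioo s (2 * s)) ^ 2 with hf
  set S : Set (Hat G) := {w | w ∈ compPts G \ {P} ∧
    ((proj G ⁻¹' {w}) ∩ {x | dist x z ∈ Ioo s (2 * s)}).Nonempty} with hS
  have hSf : ∑' w : (compPts G \ {P} : Set (Hat G)), f w = ∑' w : S, f w := by
    rw [tsum_subtype, tsum_subtype]
    congr 1
    ext w
    by_cases hw : w ∈ S
    · rw [indicator_of_mem hw, indicator_of_mem hw.1]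
    · rw [indicator_of_notMem hw]
      by_cases hw' : w ∈ compPts G \ {P}
      · rw [indicator_of_mem hw']
        have : ((fun x => dist x z) '' (proj G ⁻¹' {w})) ∩ Ioo s (2 * s) = ∅ := by
          rw [← not_nonempty_iff_eq_empty]
          rintro ⟨_, ⟨x, hx, rfl⟩, hxs⟩
          exact hw ⟨hw', x, hx, hxs⟩
        simp only [hf, this, measure_empty]
        norm_num
      · rw [indicator_of_notMem hw']
  change ∑' w : (compPts G \ {P} : Set (Hat G)), f w ≤ _
  rw [hSf]
  have hlab : ∀ w : S, ∃ q ∈ complComps D, q ⊆ proj G ⁻¹' {w.1} ∧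
      f w ≤ 4096 * area (q ∩ Metric.closedBall z (5 * s)) + 8 * ENNReal.ofReal (ε q) := by
    rintro ⟨w, ⟨hwc, hwP⟩, x, hxw, hxs⟩
    obtain ⟨hsmall, q, hq, hqp, hqQ, hQq, c, r, hr, hqc, hrd⟩ := hlike w hwc hwP
      ⟨x, hxw, hxs.2⟩
    refine ⟨q, hq, hqQ, ?_⟩
    have hqcl := complComps_isClosed hD hq
    have hr1 : r ≤ 1 := by
      refine hrd.trans ((Metric.diam_mono (hqQ.trans hsmall) Metric.isBounded_ball).trans ?_)
      refine (Metric.diam_ball (by norm_num)).trans (by norm_num)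
    obtain ⟨y, hyq, hy⟩ := exists_near_of_mem_cthickening hqcl (hε q) (hQq hxw)
    -- The effective radius at scale `s`: the image in `(s, 2 * s)` is limited by the thickened disk
    -- if `r ≤ s`, and by the width of the annulus otherwise.
    set t := min r s with ht
    have ht0 : 0 ≤ t := le_min hr hs.le
    have hvol : volume (((fun x => dist x z) '' (proj G ⁻¹' {w})) ∩ Ioo s (2 * s)) ≤
        ENNReal.ofReal (2 * (t + ε q)) := by
      rcases le_total r s with hrs | hrs
      · rw [ht, min_eq_left hrs]
        refine (measure_mono (t := Icc (dist c z - (r + ε q)) (dist c z + (r + ε q))) ?_).trans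
          (le_of_eq ?_)
        · rintro _ ⟨⟨v, hv, rfl⟩, -⟩
          obtain ⟨v', hv'q, hv'⟩ := exists_near_of_mem_cthickening hqcl (hε q) (hQq hv)
          have hv'c : dist v' c ≤ r := by rw [hqc] at hv'q; exact hv'q
          have hvc : dist v c ≤ r + ε q := (dist_triangle v v' c).trans (by linarith)
          have h1 := dist_triangle v c z
          have h2 := dist_triangle c v z
          rw [dist_comm c v] at h2
          constructor <;> simp only <;> linarith
        · rw [Real.volume_Icc]
          congr 1
          ring
      · rw [ht, min_eq_right hrs]
        refine (measure_mono inter_subset_right).trans ?_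
        rw [Real.volume_Ioo]
        exact ENNReal.ofReal_le_ofReal (by linarith [hε q])
    have harea : ENNReal.ofReal (t ^ 2 / 512) ≤ area (q ∩ Metric.closedBall z (5 * s)) := by
      have hyc : dist y c ≤ r := by rw [hqc] at hyq; exact hyq
      refine (le_area_disk_inter hr1 ht0 (min_le_left _ _) hyc).trans (measure_mono ?_)
      rw [← hqc]
      refine inter_subset_inter_right _ (Metric.closedBall_subset_closedBall' ?_)
      have h1 : dist y z ≤ 3 * s := by
        have := dist_triangle y x z
        rw [dist_comm y x] at this
        have h2 := hxs.2
        have h3 := hεs q hq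
        linarith
      linarith [min_le_right r s]
    calc f w ≤ ENNReal.ofReal (2 * (t + ε q)) ^ 2 := by
          simp only [hf]
          gcongr
      _ = ENNReal.ofReal ((2 * (t + ε q)) ^ 2) := by
          rw [ENNReal.ofReal_pow (by linarith [hε q])]
      -- This is `(2 * (t + ε)) ^ 2 ≤ 8 * t ^ 2 + 8 * ε ^ 2` with `ε ≤ 1`, so the summable errors
      -- enter linearly.
      _ ≤ ENNReal.ofReal (4096 * (t ^ 2 / 512) + 8 * ε q) := by
          refine ENNReal.ofReal_le_ofReal ?_
          nlinarith [hε q, hε1 q hq, sq_nonneg (t - ε q), mul_nonneg (hε q) (sub_nonneg.2 (hε1 q hq))]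
      _ = 4096 * ENNReal.ofReal (t ^ 2 / 512) + 8 * ENNReal.ofReal (ε q) := by
          rw [ENNReal.ofReal_add (by positivity) (by linarith [hε q]),
            ENNReal.ofReal_mul (by norm_num), ENNReal.ofReal_mul (by norm_num)]
          norm_num
      _ ≤ _ := by gcongr
  choose q hq hqQ hqf using hlab
  have hdis : Pairwise (Function.onFun Disjoint fun w : S => q w ∩ Metric.closedBall z (5 * s)) := by
    intro v w hvw
    refine Disjoint.mono (inter_subset_left.trans (hqQ v)) (inter_subset_left.trans (hqQ w)) ?_
    refine disjoint_left.2 fun x hxv hxw => hvw (Subtype.ext ?_)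
    exact (show proj G x = v.1 from hxv).symm.trans (show proj G x = w.1 from hxw)
  -- Distinct collapsed components contain distinct disks, so the sum of their errors is bounded by
  -- the full sum over the components of `Dᶜ`.
  have hinj : Function.Injective fun w : S => (⟨q w, hq w⟩ : complComps D) := by
    intro v w hvw
    have hvw' : q v = q w := congrArg Subtype.val hvw
    obtain ⟨x, hx⟩ := complComps_nonempty (hq v)
    have h1 : proj G x = v.1 := hqQ v hx
    have h2 : proj G x = w.1 := hqQ w (hvw' ▸ hx)
    exact Subtype.ext (h1.symm.trans h2)
  calc ∑' w : S, f w
      ≤ ∑' w : S, (4096 * area (q w ∩ Metric.closedBall z (5 * s)) +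
          8 * ENNReal.ofReal (ε (q w))) := ENNReal.tsum_le_tsum hqf
    _ = 4096 * ∑' w : S, area (q w ∩ Metric.closedBall z (5 * s)) +
          8 * ∑' w : S, ENNReal.ofReal (ε (q w)) := by
        rw [ENNReal.tsum_add, ENNReal.tsum_mul_left, ENNReal.tsum_mul_left]
    _ ≤ 4096 * ENNReal.ofReal (24 * (5 * s) ^ 2) + 8 * ENNReal.ofReal (s ^ 2) := by
        refine add_le_add (mul_le_mul_right ?_ _) (mul_le_mul_right ?_ _)
        · refine (tsum_meas_le_meas_iUnion_of_disjoint area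
            (fun w => ((complComps_isClosed hD (hq w)).inter
              Metric.isClosed_closedBall).measurableSet) hdis).trans ?_
          exact (measure_mono (iUnion_subset fun w => inter_subset_right)).trans
            (area_closedBall_le z (by positivity))
        · exact (ENNReal.tsum_comp_le_tsum_of_injective hinj
            (fun q => ENNReal.ofReal (ε q.1))).trans hsum
    _ ≤ ENNReal.ofReal (2500000 * s ^ 2) := by
        have h1 : (4096 : ℝ≥0∞) = ENNReal.ofReal 4096 := by simp
        have h2 : (8 : ℝ≥0∞) = ENNReal.ofReal 8 := by simp
        rw [h1, h2, ← ENNReal.ofReal_mul (by norm_num), ← ENNReal.ofReal_mul (by norm_num),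
          ← ENNReal.ofReal_add (by positivity) (by positivity)]
        exact ENNReal.ofReal_le_ofReal (by nlinarith [sq_nonneg s])

end Scales

/-! ### The logarithmic density -/

section Density

variable {G : Set RSphere} {z : RSphere}

/-- The annuli are disjoint, and each contributes at most `(1 / (N * τ n)) ^ 2 * 24 * (2 * τ n) ^ 2
= 96 / N ^ 2`. -/
theorem lintegral_stepFun_sq_le {N : ℕ} (hN : 0 < N) {τ : ℕ → ℝ} (hτ : ∀ n, 0 < τ n)
    (hτ' : ∀ m n, m < n → 2 * τ n ≤ τ m) :
    ∫⁻ x in G, stepFun (Finset.range N) (fun n => ENNReal.ofReal (1 / (N * τ n)))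
      (fun n => Ioo (τ n) (2 * τ n)) (dist x z) ^ 2 ∂area ≤ ENNReal.ofReal (96 / N) := by
  have hN' : (0 : ℝ) < N := by exact_mod_cast hN
  have hmeas : ∀ n, MeasurableSet {x : RSphere | dist x z ∈ Ioo (τ n) (2 * τ n)} := fun n =>
    (isOpen_Ioo.preimage (f := fun x : RSphere => dist x z) (by fun_prop)).measurableSet
  have hsq : ∀ x : RSphere, stepFun (Finset.range N) (fun n => ENNReal.ofReal (1 / (N * τ n)))
      (fun n => Ioo (τ n) (2 * τ n)) (dist x z) ^ 2 =
      ∑ n ∈ Finset.range N, {x : RSphere | dist x z ∈ Ioo (τ n) (2 * τ n)}.indicator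
        (fun _ => ENNReal.ofReal (1 / (N * τ n)) ^ 2) x := by
    intro x
    unfold stepFun
    rw [sq_sum_le_of_unique_ne_zero]
    · refine Finset.sum_congr rfl fun n _ => ?_
      by_cases h : dist x z ∈ Ioo (τ n) (2 * τ n)
      · rw [indicator_of_mem h, indicator_of_mem (show x ∈ {x : RSphere | dist x z ∈ Ioo (τ n) (2 * τ n)} from h)]
      · rw [indicator_of_notMem h, indicator_of_notMem (show x ∉ {x : RSphere | dist x z ∈ Ioo (τ n) (2 * τ n)} from h)]
        norm_num
    · have key : ∀ m n, m < n → (Ioo (τ m) (2 * τ m)).indicator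
          (fun _ => ENNReal.ofReal (1 / (N * τ m))) (dist x z) = 0 ∨
          (Ioo (τ n) (2 * τ n)).indicator
          (fun _ => ENNReal.ofReal (1 / (N * τ n))) (dist x z) = 0 := by
        intro m n hmn
        by_cases h : dist x z ∈ Ioo (τ m) (2 * τ m)
        · right
          refine indicator_of_notMem (fun h' => ?_) _
          linarith [h.1, h'.2, hτ' m n hmn]
        · exact Or.inl (indicator_of_notMem h _)
      intro m _ n _ hmn
      rcases lt_or_gt_of_ne hmn with h | h
      · exact key m n h
      · exact (key n m h).symm
  simp only [hsq]
  rw [lintegral_finsetSum _ fun n _ => measurable_const.indicator (hmeas n)]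
  calc ∑ n ∈ Finset.range N, ∫⁻ x in G, {x : RSphere | dist x z ∈ Ioo (τ n) (2 * τ n)}.indicator
        (fun _ => ENNReal.ofReal (1 / (N * τ n)) ^ 2) x ∂area
      ≤ ∑ n ∈ Finset.range N, ENNReal.ofReal (96 / N ^ 2) := by
        refine Finset.sum_le_sum fun n _ => ?_
        rw [lintegral_indicator (hmeas n), setLIntegral_const]
        have h1 : (area.restrict G) {x : RSphere | dist x z ∈ Ioo (τ n) (2 * τ n)} ≤
            ENNReal.ofReal (24 * (2 * τ n) ^ 2) := by
          refine (Measure.restrict_apply_le _ _).trans ((measure_mono ?_).trans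
            (area_closedBall_le z (by linarith [hτ n])))
          exact fun x hx => hx.2.le
        refine (mul_le_mul_right h1 _).trans ?_
        have hτn := hτ n
        rw [← ENNReal.ofReal_pow (by positivity), ← ENNReal.ofReal_mul (by positivity)]
        refine ENNReal.ofReal_le_ofReal (le_of_eq ?_)
        field_simp
        norm_num
    _ = ENNReal.ofReal (96 / N) := by
        rw [Finset.sum_const, Finset.card_range, nsmul_eq_mul, ← ENNReal.ofReal_natCast,
          ← ENNReal.ofReal_mul (by positivity)]
        congr 1
        field_simp

/-- The logarithmic modulus bound: if paths have to cross `N` consecutive annuli around `z` no two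
of which are met by the same atom, the atoms in each annulus having controlled total mass, then the
transboundary modulus is `O(1 / N)`. -/
theorem transboundaryMod_le (hG : IsOpen G) (hfin : (complComps G).Finite) (P : Hat G) {N : ℕ}
    (hN : 0 < N) {τ : ℕ → ℝ} (hτ : ∀ n, 0 < τ n) (hτ' : ∀ n, 2 * τ (n + 1) ≤ τ n)
    (hsep : ∀ n, n + 1 < N → ∀ w ∈ compPts G, w ≠ P → ∀ x ∈ proj G ⁻¹' {w}, τ n ≤ dist x z →
      ∀ y ∈ proj G ⁻¹' {w}, 2 * τ (n + 1) ≤ dist y z) {C : ℝ} (hC : 0 ≤ C)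
    (hatom : ∀ n < N, ∑' w : (compPts G \ {P} : Set (Hat G)),
      volume (((fun x => dist x z) '' (proj G ⁻¹' {w.1})) ∩ Ioo (τ n) (2 * τ n)) ^ 2 ≤
        ENNReal.ofReal (C * τ n ^ 2))
    {Γ : Set C(I, Hat G)} {r R : ℝ} (hr : ∀ n < N, r ≤ τ n) (hR : 2 * τ 0 ≤ R)
    (hΓ : ∀ γ ∈ Γ, ∃ x₀ x₁, γ 0 = proj G x₀ ∧ γ 1 = proj G x₁ ∧ dist x₀ z ≤ r ∧ R ≤ dist x₁ z)
    (hP : ∀ γ ∈ Γ, P ∉ range γ ∨ ∀ x ∈ proj G ⁻¹' {P}, dist x z ≤ r) :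
    transboundaryMod G Γ ≤ ENNReal.ofReal ((96 + C) / N) := by
  classical
  have hN' : (0 : ℝ) < N := by exact_mod_cast hN
  have hanti : Antitone τ := antitone_nat_of_succ_le fun n => by linarith [hτ' n, hτ (n + 1)]
  have hlt : ∀ m n, m < n → 2 * τ n ≤ τ m := fun m n hmn =>
    (by linarith [hanti (Nat.succ_le_of_lt hmn)] : 2 * τ n ≤ 2 * τ (m + 1)).trans (hτ' m)
  set d : RSphere → ℝ := fun x => dist x z with hd
  have hdL : LipschitzWith 1 d := LipschitzWith.dist_left z
  set c : ℕ → ℝ≥0∞ := fun n => ENNReal.ofReal (1 / (N * τ n)) with hc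
  set A : ℕ → Set ℝ := fun n => Ioo (τ n) (2 * τ n) with hA
  set s := Finset.range N with hs
  have hAo : ∀ n ∈ s, IsOpen (A n) := fun n _ => isOpen_Ioo
  have hfin' : (compPts G).Finite := finite_compPts hfin
  -- Each atom gets exactly the weight of the radii it lets a path skip; the exceptional atom `P`
  -- gets none.
  set a : Hat G → ℝ≥0∞ := fun w =>
    if w = P then 0 else stepMeasure s c A (d '' (proj G ⁻¹' {w})) with ha
  set ρ : Hat G → ℝ≥0∞ := fun w =>
    (∑ n ∈ s, (proj G '' (G ∩ d ⁻¹' A n)).indicator (fun _ => c n) w) +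
      ∑ v ∈ hfin'.toFinset, ({v} : Set (Hat G)).indicator (fun _ => a v) w with hρ
  have hρmeas : Measurable ρ := by
    refine Measurable.add (Finset.measurable_sum _ fun n _ => measurable_const.indicator ?_)
      (Finset.measurable_sum _ fun v _ => measurable_const.indicator ?_)
    · exact (isOpen_image_proj (hG.inter (isOpen_Ioo.preimage hdL.continuous))
        inter_subset_left).measurableSet
    · exact (isClosed_singleton_hat hG v).measurableSet
  have hmemG : ∀ x, proj G x ∈ proj G '' G ↔ x ∈ G := fun x => by
    rw [← mem_preimage, preimage_image_proj Subset.rfl]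
  have hρG : ∀ x ∈ G, ρ (proj G x) = stepFun s c A (d x) := by
    intro x hx
    have h1 : ∑ v ∈ hfin'.toFinset, ({v} : Set (Hat G)).indicator (fun _ => a v) (proj G x) = 0 := by
      refine Finset.sum_eq_zero fun v hv => indicator_of_notMem (fun h => ?_) _
      rw [Finite.mem_toFinset, ← show proj G x = v from h, compPts_eq_compl] at hv
      exact hv ((hmemG x).2 hx)
    simp only [hρ, h1, add_zero]
    unfold stepFun
    refine Finset.sum_congr rfl fun n _ => ?_
    have : proj G x ∈ proj G '' (G ∩ d ⁻¹' A n) ↔ d x ∈ A n := by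
      rw [← mem_preimage, preimage_image_proj inter_subset_left]
      exact and_iff_right hx
    by_cases h : d x ∈ A n
    · rw [indicator_of_mem h, indicator_of_mem (this.2 h)]
    · rw [indicator_of_notMem h, indicator_of_notMem (fun h' => h (this.1 h'))]
  have hρc : ∀ w ∈ compPts G, ρ w = a w := by
    intro w hw
    have h0 : ∑ n ∈ s, (proj G '' (G ∩ d ⁻¹' A n)).indicator (fun _ => c n) w = 0 := by
      refine Finset.sum_eq_zero fun n _ => indicator_of_notMem (fun h => ?_) _
      rw [compPts_eq_compl] at hw
      exact hw (image_mono inter_subset_left h)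
    have h1 : ∑ v ∈ hfin'.toFinset, ({v} : Set (Hat G)).indicator (fun _ => a v) w = a w := by
      rw [Finset.sum_eq_single w]
      · exact indicator_of_mem (mem_singleton w) _
      · exact fun v _ hvw => indicator_of_notMem (fun h => hvw (show w = v from h).symm) _
      · exact fun h => (h (hfin'.mem_toFinset.2 hw)).elim
    simp only [hρ, h0, h1, zero_add]
  have hadm : IsAdmissible G Γ ρ := by
    refine ⟨hρmeas, fun γ hγ => ?_⟩
    obtain ⟨x₀, x₁, h₀, h₁, hx₀, hx₁⟩ := hΓ γ hγ
    have key := stepMeasure_Ioo_le_length (s := s) (c := c) (A := A) hdL hAo hG hfin γ (ρ := ρ)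
      (fun x hx => (hρG x hx).ge) (fun w hw => by
        rw [hρc w hw.1]
        simp only [ha]
        split_ifs with hwP
        · rcases hP γ hγ with h | h
          · exact (h (hwP ▸ hw.2)).elim
          · rw [stepMeasure_apply hAo]
            refine le_of_eq (Finset.sum_eq_zero fun n hn => ?_)
            have : d '' (proj G ⁻¹' {w}) ∩ A n = ∅ := by
              rw [← not_nonempty_iff_eq_empty]
              rintro ⟨_, ⟨x, hx, rfl⟩, hxn⟩
              rw [hwP] at hx
              have h1 := h x hx
              have h2 := hr n (Finset.mem_range.1 hn)
              exact absurd hxn.1 (not_lt.2 (h1.trans h2))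
            rw [this, measure_empty, mul_zero]
        · exact le_rfl) h₀ h₁ hx₀ hx₁
    refine le_trans (le_of_eq ?_) key
    rw [stepMeasure_apply hAo]
    have : ∀ n ∈ s, c n * volume (Ioo r R ∩ A n) = ENNReal.ofReal (1 / N) := by
      intro n hn
      have hτn := hτ n
      rw [inter_eq_right.2 (Ioo_subset_Ioo (hr n (Finset.mem_range.1 hn))
        ((by linarith [hanti (Nat.zero_le n)] : 2 * τ n ≤ 2 * τ 0).trans hR)), Real.volume_Ioo, hc,
        ← ENNReal.ofReal_mul (by positivity)]
      congr 1
      field_simp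
      ring
    rw [Finset.sum_congr rfl this, Finset.sum_const, hs, Finset.card_range, nsmul_eq_mul,
      ← ENNReal.ofReal_natCast, ← ENNReal.ofReal_mul (by positivity), mul_one_div_cancel hN'.ne',
      ENNReal.ofReal_one]
  have hmassG : ∫⁻ x in G, ρ (proj G x) ^ 2 ∂area ≤ ENNReal.ofReal (96 / N) := by
    rw [setLIntegral_congr_fun hG.measurableSet (g := fun x => stepFun s c A (d x) ^ 2)
      (fun x hx => by simp only [hρG x hx])]
    exact lintegral_stepFun_sq_le hN hτ hlt
  have hmassC : ∑' w : compPts G, ρ w ^ 2 ≤ ENNReal.ofReal (C / N) := by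
    have hT : ∑' w : compPts G, ρ w ^ 2 = ∑' w : (compPts G \ {P} : Set (Hat G)), ρ w ^ 2 := by
      rw [tsum_subtype (compPts G) (fun w => ρ w ^ 2),
        tsum_subtype (compPts G \ {P}) (fun w => ρ w ^ 2)]
      congr 1
      ext w
      by_cases hw : w ∈ compPts G
      · by_cases hwP : w = P
        · rw [indicator_of_mem hw, indicator_of_notMem (fun h => h.2 hwP), hρc w hw]
          simp [ha, hwP]
        · rw [indicator_of_mem hw, indicator_of_mem (show w ∈ compPts G \ {P} from ⟨hw, hwP⟩)]
      · rw [indicator_of_notMem hw, indicator_of_notMem (fun h => hw h.1)]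
    rw [hT]
    have hsq : ∀ w : (compPts G \ {P} : Set (Hat G)), ρ w ^ 2 =
        ∑ n ∈ s, c n ^ 2 * volume (d '' (proj G ⁻¹' {w.1}) ∩ A n) ^ 2 := by
      rintro ⟨w, hw, hwP⟩
      have hwP' : w ≠ P := hwP
      -- By `hsep`, an atom meeting annulus `m` stays outside all the inner ones. So its weight has
      -- at most one nonzero term, and its square is the sum of the squares.
      have key : ∀ m n, m < n → n < N → c m * volume (d '' (proj G ⁻¹' {w}) ∩ A m) = 0 ∨
          c n * volume (d '' (proj G ⁻¹' {w}) ∩ A n) = 0 := by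
        intro m n hmn hn
        by_cases h : (d '' (proj G ⁻¹' {w}) ∩ A m).Nonempty
        · right
          obtain ⟨_, ⟨x, hx, rfl⟩, hxm⟩ := h
          have : d '' (proj G ⁻¹' {w}) ∩ A n = ∅ := by
            rw [← not_nonempty_iff_eq_empty]
            rintro ⟨_, ⟨y, hy, rfl⟩, hyn⟩
            have h1 := hsep m (by omega) w hw hwP' x hx hxm.1.le y hy
            have h2 : τ n ≤ τ (m + 1) := hanti (by omega)
            have h3 : dist y z < 2 * τ n := hyn.2
            linarith
          rw [this, measure_empty, mul_zero]
        · left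
          rw [not_nonempty_iff_eq_empty.1 h, measure_empty, mul_zero]
      rw [hρc w hw]
      simp only [ha, if_neg hwP']
      rw [stepMeasure_apply hAo, sq_sum_le_of_unique_ne_zero]
      · simp only [mul_pow]
      · intro m hm n hn hmn
        rcases lt_or_gt_of_ne hmn with h | h
        · exact key m n h (Finset.mem_range.1 hn)
        · exact (key n m h (Finset.mem_range.1 hm)).symm
    simp only [hsq]
    rw [Summable.tsum_finsetSum fun n _ => ENNReal.summable]
    calc ∑ n ∈ s, ∑' w : (compPts G \ {P} : Set (Hat G)),
          c n ^ 2 * volume (d '' (proj G ⁻¹' {w.1}) ∩ A n) ^ 2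
        ≤ ∑ n ∈ s, ENNReal.ofReal (C / N ^ 2) := by
          refine Finset.sum_le_sum fun n hn => ?_
          have hτn := hτ n
          rw [ENNReal.tsum_mul_left]
          refine (mul_le_mul_right (hatom n (Finset.mem_range.1 hn)) _).trans ?_
          rw [hc, ← ENNReal.ofReal_pow (by positivity), ← ENNReal.ofReal_mul (by positivity)]
          refine ENNReal.ofReal_le_ofReal (le_of_eq ?_)
          field_simp
      _ = ENNReal.ofReal (C / N) := by
          rw [Finset.sum_const, hs, Finset.card_range, nsmul_eq_mul, ← ENNReal.ofReal_natCast,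
            ← ENNReal.ofReal_mul (by positivity)]
          congr 1
          field_simp
  calc transboundaryMod G Γ ≤ _ := iInf₂_le ρ hadm
    _ ≤ ENNReal.ofReal (96 / N) + ENNReal.ofReal (C / N) := add_le_add hmassG hmassC
    _ = ENNReal.ofReal ((96 + C) / N) := by
      rw [← ENNReal.ofReal_add (by positivity) (by positivity), add_div]

end Density

/-! ### Modulus of paths that start near a complementary component -/

section Modulus

variable {D p : Set RSphere} {E : ℕ → Set RSphere} {z : RSphere} {R : ℝ}
  {ε : ℕ → Set RSphere → ℝ} {δ : ℕ → ℝ}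

theorem IsExhaustion.preimage_proj_center (hE : IsExhaustion D E) (hp : p ∈ complComps D)
    (hz : z ∈ p) (j : ℕ) : proj (E j) ⁻¹' {proj (E j) z} = compOver (E j) p :=
  preimage_proj_of_mem_comp (hE.compOver_mem j hp) (hE.subset_compOver j hp hz)

/-- Iterating `exists_scale` yields the radii. Only finitely many separations are needed for a given
`N`, so they hold simultaneously for all large `j`. -/
theorem IsExhaustion.eventually_transboundaryMod_le (hE : IsExhaustion D E)
    (hp : p ∈ complComps D) (hz : z ∈ p) (hR : 0 < R)
    (hε : ∀ j q, 0 ≤ ε j q) (hεδ : ∀ j, ∀ q ∈ complComps D, ε j q ≤ δ j)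
    (hδ : Tendsto δ atTop (𝓝 0))
    (hsum : ∀ j, ∑' q : complComps D, ENNReal.ofReal (ε j q) ≤ ENNReal.ofReal (δ j))
    (hlike : ∀ᶠ j in atTop, ∀ Q ∈ complComps (E j), Q ≠ compOver (E j) p →
      (Q ∩ Metric.ball z R).Nonempty → IsDiskLike D p (ε j) Q) {N : ℕ} (hN : 0 < N) :
    ∃ r₀ > 0, ∀ᶠ j in atTop, ∀ Γ : Set C(I, Hat (E j)),
      (∀ γ ∈ Γ, ∃ x₀ x₁, γ 0 = proj (E j) x₀ ∧ γ 1 = proj (E j) x₁ ∧ dist x₀ z ≤ r₀ ∧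
        R ≤ dist x₁ z) →
      (∀ γ ∈ Γ, proj (E j) z ∉ range γ ∨ ∀ x ∈ compOver (E j) p, dist x z ≤ r₀) →
      transboundaryMod (E j) Γ ≤ ENNReal.ofReal (2500096 / N) := by
  choose! sc hsc0 hscR hsc2 hsc using fun s (hs : 0 < s) =>
    exists_scale hE.isOpen hp hz hR hε hεδ hδ hlike hs
  -- The annuli use `u 1, …, u N`. The initial `u 0 = 1 / 2` keeps components meeting them in a ball
  -- of radius `1 / 2`, so their disks have radius at most one; `u (N + 1)` is the starting radius.
  set u : ℕ → ℝ := fun n => sc^[n] (1 / 2) with hu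
  have hus : ∀ n, u (n + 1) = sc (u n) := fun n => Function.iterate_succ_apply' _ _ _
  have hu0 : ∀ n, 0 < u n := by
    intro n
    induction n with
    | zero => simp [hu]
    | succ n ih => rw [hus]; exact hsc0 _ ih
  have hu2 : ∀ n, 2 * u (n + 1) ≤ u n := fun n => by
    have := hsc2 _ (hu0 n)
    rw [hus]
    linarith
  have hanti : Antitone u := antitone_nat_of_succ_le fun n => by linarith [hu2 n, hu0 (n + 1)]
  refine ⟨u (N + 1), hu0 _, ?_⟩
  have hev : ∀ᶠ j in atTop, ∀ n ∈ Finset.range (N + 1), ∀ Q ∈ complComps (E j),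
      Q ≠ compOver (E j) p → ∀ x ∈ Q, u n ≤ dist x z → ∀ y ∈ Q, 2 * u (n + 1) ≤ dist y z := by
    rw [Filter.eventually_all_finset]
    intro n _
    filter_upwards [hsc _ (hu0 n)] with j hj
    rw [hus]
    exact hj
  have hδN : ∀ᶠ j in atTop, δ j < min (min (u (N + 1)) 1) (u (N + 1) ^ 2) :=
    hδ.eventually_lt_const (by have := hu0 (N + 1); positivity)
  filter_upwards [hev, hδN, hlike] with j hj hδj hlikej Γ hΓ hP
  have hG := (hE.isDom j).1
  have hfin := hE.finite_complComps j
  have hcenter := hE.preimage_proj_center hp hz j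
  have hcomp : ∀ w ∈ compPts (E j), w ≠ proj (E j) z →
      proj (E j) ⁻¹' {w} ∈ complComps (E j) ∧ proj (E j) ⁻¹' {w} ≠ compOver (E j) p := by
    refine fun w hw hwP => ⟨preimage_proj_mem_complComps hw, fun h => hwP ?_⟩
    exact preimage_proj_injective (E j) (h.trans hcenter.symm)
  have hδ1 : δ j ≤ u (N + 1) := hδj.le.trans ((min_le_left _ _).trans (min_le_left _ _))
  have hδ2 : δ j ≤ 1 := hδj.le.trans ((min_le_left _ _).trans (min_le_right _ _))
  have hδ3 : δ j ≤ u (N + 1) ^ 2 := hδj.le.trans (min_le_right _ _)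
  have hfinal := transboundaryMod_le (G := E j) (z := z) hG hfin (proj (E j) z) hN
    (τ := fun n => u (n + 1)) (fun n => hu0 _) (fun n => hu2 _)
    (fun n hn w hw hwP => hj (n + 1) (Finset.mem_range.2 (by omega)) _ (hcomp w hw hwP).1
      (hcomp w hw hwP).2) (C := 2500000) (by norm_num)
    (fun n hn => by
      have hle : u (N + 1) ≤ u (n + 1) := hanti (by omega)
      have hle1 : u (n + 1) ≤ u 1 := hanti (by omega)
      refine sum_sq_volume_le (p := p) (ε := ε j) (hu0 _) hE.isOpen (hε j)
        (fun q hq => (hεδ j q hq).trans (hδ1.trans hle)) (fun q hq => (hεδ j q hq).trans hδ2)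
        ((hsum j).trans (ENNReal.ofReal_le_ofReal (hδ3.trans ?_))) ?_
      · exact pow_le_pow_left₀ (hu0 _).le hle 2
      · rintro w hw hwP ⟨y, hyw, hy⟩
        obtain ⟨h1, h2⟩ := hcomp w hw hwP
        have hyd : dist y z < 2 * u (n + 1) := hy
        refine ⟨fun x hx => ?_, hlikej _ h1 h2 ⟨y, hyw, ?_⟩⟩
        · by_contra hxz
          have h3 := hj 0 (Finset.mem_range.2 (by omega)) _ h1 h2 x hx
            (not_lt.1 hxz) y hyw
          rw [zero_add] at h3
          linarith
        · have h4 := hscR _ (hu0 0)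
          rw [← hus, zero_add] at h4
          exact hyd.trans_le (by linarith))
    (Γ := Γ) (r := u (N + 1)) (R := R) (fun n hn => hanti (by omega))
    (by
      have h4 := hscR _ (hu0 0)
      rw [← hus] at h4
      exact h4) hΓ (by rw [hcenter]; exact hP)
  norm_num at hfinal ⊢
  exact hfinal

end Modulus

/-! ### Summable errors and the proof of the proposition -/

theorem exists_nat_ofReal_div_le (C : ℝ) {e : ℝ≥0∞} (he : 0 < e) :
    ∃ N : ℕ, 0 < N ∧ ENNReal.ofReal (C / N) ≤ e := by
  have h : Tendsto (fun N : ℕ => ENNReal.ofReal (C / N)) atTop (𝓝 0) := by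
    have := ENNReal.tendsto_ofReal (tendsto_const_div_atTop_nhds_zero_nat C)
    rwa [ENNReal.ofReal_zero] at this
  obtain ⟨N, hN1, hN2⟩ := ((eventually_gt_atTop 0).and (h.eventually_le_const he)).exists
  exact ⟨N, hN1, hN2⟩

/-- With `i` an injective numbering, `ε j q = 2 ^ (-j - i q)` and `δ j = 2 * 2 ^ (-j)`. -/
theorem exists_summable_errors {S : Set (Set RSphere)} (hS : S.Countable) :
    ∃ (ε : ℕ → Set RSphere → ℝ) (δ : ℕ → ℝ), (∀ j q, 0 < ε j q) ∧
      (∀ j q, ε (j + 1) q ≤ ε j q) ∧ (∀ j, ∀ q ∈ S, ε j q ≤ δ j) ∧ Tendsto δ atTop (𝓝 0) ∧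
      ∀ j, ∑' q : S, ENNReal.ofReal (ε j q) ≤ ENNReal.ofReal (δ j) := by
  obtain ⟨i, hi⟩ := countable_iff_exists_injOn.1 hS
  have hgeo : ∑' n : ℕ, ENNReal.ofReal ((1 / 2 : ℝ) ^ n) = ENNReal.ofReal 2 := by
    rw [← ENNReal.ofReal_tsum_of_nonneg (fun n => by positivity) summable_geometric_two,
      tsum_geometric_two]
  refine ⟨fun j q => (1 / 2) ^ j * (1 / 2) ^ i q, fun j => (1 / 2) ^ j * 2, fun j q => by positivity,
    fun j q => ?_, fun j q _ => ?_, ?_, fun j => ?_⟩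
  · refine mul_le_mul_of_nonneg_right ?_ (by positivity)
    exact pow_le_pow_of_le_one (by norm_num) (by norm_num) (Nat.le_succ j)
  · refine mul_le_mul_of_nonneg_left ?_ (by positivity)
    exact (pow_le_one₀ (by norm_num) (by norm_num)).trans one_le_two
  · have := (tendsto_pow_atTop_nhds_zero_of_lt_one (r := (1 / 2 : ℝ)) (by norm_num)
      (by norm_num)).mul_const 2
    rwa [zero_mul] at this
  · have hinj : Function.Injective fun q : S => i q := hi.injective
    simp only [ENNReal.ofReal_mul (show (0 : ℝ) ≤ (1 / 2) ^ j by positivity)]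
    rw [ENNReal.tsum_mul_left, ← hgeo]
    exact mul_le_mul_right (ENNReal.tsum_comp_le_tsum_of_injective hinj
      fun n => ENNReal.ofReal ((1 / 2 : ℝ) ^ n)) _

end PlanarExhaustion

theorem proposition2p4
    (D : Set PlanarExhaustion.RSphere) (hD : PlanarExhaustion.IsCountablyConnected D)
    (D' : ℕ → Set PlanarExhaustion.RSphere) (hD' : PlanarExhaustion.IsExhaustion D D')
    (hnest : PlanarExhaustion.IsStrictlyNested D')
    (p : Set PlanarExhaustion.RSphere) (hp : p ∈ PlanarExhaustion.complComps D)
    (U : Set PlanarExhaustion.RSphere) (hU : IsOpen U) (hpU : p ⊆ U)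
    (hUn : ∃ n, closure U ∈ PlanarExhaustion.complComps (D' n))
    (hdisk : ∀ q ∈ PlanarExhaustion.complComps D, q ≠ p → q ⊆ U →
      PlanarExhaustion.IsClosedDisk q) :
    ∃ Dp : ℕ → Set PlanarExhaustion.RSphere,
      PlanarExhaustion.IsExhaustion D Dp ∧
      PlanarExhaustion.IsRefinement Dp D' ∧
      (∀ j, Dp j \ U = D' j \ U) ∧
      ∀ E : ℕ → Set PlanarExhaustion.RSphere,
        PlanarExhaustion.IsExhaustion D E → PlanarExhaustion.IsRefinement E Dp →
        (∀ z ∈ p,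
          Tendsto
            (fun r : ℝ => limsup
              (fun j : ℕ => PlanarExhaustion.modJoinAvoiding (E j)
                (Metric.sphere z r \ PlanarExhaustion.compOver (E j) p) (frontier U)
                (PlanarExhaustion.compOver (E j) p))
              atTop)
            (𝓝[>] (0 : ℝ)) (𝓝 (0 : ENNReal))) ∧
        (p.Subsingleton → ∀ z ∈ p,
          Tendsto
            (fun r : ℝ => limsup
              (fun j : ℕ => PlanarExhaustion.modJoin (E j)
                (Metric.sphere z r \ PlanarExhaustion.compOver (E j) p) (frontier U))
              atTop)
            (𝓝[>] (0 : ℝ)) (𝓝 (0 : ENNReal))) := by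
  open PlanarExhaustion in
  obtain ⟨ε, δ, hε, hanti, hεδ, hδ, hsum⟩ := exists_summable_errors hD.2
  obtain ⟨m, hm⟩ := hD'.eventually_compOver_subset hp hU hpU
  set K := compOver (D' m) p with hKdef
  have hKU : K ⊆ U := hm m le_rfl
  have hK : K ∈ complComps (D' m) := hD'.compOver_mem m hp
  obtain ⟨Dp, hDp, href, hDpK, happrox⟩ := hD'.exists_refinement hK hε hanti
  refine ⟨Dp, hDp, href, fun j => ?_, fun E hE hEref => ?_⟩
  · ext x
    have := Set.ext_iff.1 (hDpK j) x
    simp only [Set.mem_sdiff] at this ⊢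
    constructor
    · exact fun h => ⟨(this.1 ⟨h.1, fun h' => h.2 (hKU h')⟩).1, h.2⟩
    · exact fun h => ⟨(this.2 ⟨h.1, fun h' => h.2 (hKU h')⟩).1, h.2⟩
  have hεmono : ∀ q, Antitone fun j => ε j q := fun q => antitone_nat_of_succ_le fun j => hanti j q
  have core : ∀ z ∈ p, ∃ R > 0, Metric.ball z R ⊆ U ∧ ∀ N : ℕ, 0 < N →
      ∃ r₀ > 0, ∀ᶠ j in atTop, ∀ Γ : Set C(I, Hat (E j)),
      (∀ γ ∈ Γ, ∃ x₀ x₁, γ 0 = proj (E j) x₀ ∧ γ 1 = proj (E j) x₁ ∧ dist x₀ z ≤ r₀ ∧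
        R ≤ dist x₁ z) →
      (∀ γ ∈ Γ, proj (E j) z ∉ range γ ∨ ∀ x ∈ compOver (E j) p, dist x z ≤ r₀) →
      transboundaryMod (E j) Γ ≤ ENNReal.ofReal (2500096 / N) := by
    intro z hz
    have hzK : z ∈ interior K := hD'.inter_compl_subset_interior hK
      ⟨hD'.subset_compOver m hp hz, complComps_subset hp hz⟩
    obtain ⟨R, hR, hRK⟩ := Metric.isOpen_iff.1 isOpen_interior z hzK
    have hRK' : Metric.ball z R ⊆ K := hRK.trans interior_subset
    refine ⟨R, hR, hRK'.trans hKU, fun N hN => ?_⟩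
    refine hE.eventually_transboundaryMod_le hp hz hR (fun j q => (hε j q).le) hεδ hδ hsum ?_ hN
    filter_upwards [eventually_ge_atTop m] with j hjm Q hQ hQp ⟨y, hyQ, hyR⟩
    obtain ⟨k, hjk, hQk⟩ := hEref j Q hQ
    obtain ⟨l, hkl, hQl⟩ := href k Q hQk
    have hQK : Q ⊆ K := hD'.nested (hjm.trans (hjk.trans hkl)) hK hQl ⟨y, hRK' hyR, hyQ⟩
    -- A component of `(E j)ᶜ` occurs in `Dp` at some stage `k ≥ j`, where the errors are at most
    -- those of stage `j`. The disk found in it differs from `p` because only one component lies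
    -- over `p`.
    obtain ⟨q, hq, hqQ, hQq⟩ := (happrox k (hjm.trans hjk) Q hQk hQK).mono
      fun q => hεmono q hjk
    have hqp : q ≠ p := by
      rintro rfl
      exact hQp (eq_compOver (hE.subset j) hp hQ hqQ)
    exact ⟨q, hq, hqp, hqQ, hQq,
      (hdisk q hq hqp (hqQ.trans (hQK.trans hKU))).exists_radius_le_diam⟩
  have hfr : ∀ z : RSphere, ∀ R : ℝ, Metric.ball z R ⊆ U → ∀ x ∈ frontier U, R ≤ dist x z := by
    intro z R hRU x hx
    by_contra! h
    exact hx.2 (hU.interior_eq.symm ▸ hRU h)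
  refine ⟨fun z hz => ?_, fun hsub z hz => ?_⟩
  · obtain ⟨R, hR, hRU, hcore⟩ := core z hz
    refine ENNReal.tendsto_nhds_zero.2 fun e he => ?_
    obtain ⟨N, hN, hNe⟩ := exists_nat_ofReal_div_le 2500096 he
    obtain ⟨r₀, hr₀, hev⟩ := hcore N hN
    filter_upwards [Ioo_mem_nhdsGT hr₀] with r hr
    refine (Filter.limsup_le_of_le (by isBoundedDefault) ?_).trans hNe
    filter_upwards [hev] with j hj
    refine hj _ ?_ ?_
    · rintro γ ⟨⟨⟨x₀, hx₀, h₀⟩, ⟨x₁, hx₁, h₁⟩⟩, -⟩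
      exact ⟨x₀, x₁, h₀.symm, h₁.symm, (show dist x₀ z = r from hx₀.1).le.trans hr.2.le,
        hfr z R hRU x₁ hx₁⟩
    · rintro γ ⟨-, hγ⟩
      exact Or.inl fun h => disjoint_left.1 hγ h ⟨z, hE.subset_compOver j hp hz, rfl⟩
  · obtain ⟨R, hR, hRU, hcore⟩ := core z hz
    refine ENNReal.tendsto_nhds_zero.2 fun e he => ?_
    obtain ⟨N, hN, hNe⟩ := exists_nat_ofReal_div_le 2500096 he
    obtain ⟨r₀, hr₀, hev⟩ := hcore N hN
    -- As `p = {z}`, the component over `p` eventually lies in the ball of radius `r₀`, inside all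
    -- the annuli, so paths may pass through it without gaining length.
    obtain ⟨k₀, hk₀⟩ := hE.eventually_compOver_subset hp (Metric.isOpen_ball (x := z) (ε := r₀))
      fun x hx => hsub hx hz ▸ Metric.mem_ball_self hr₀
    filter_upwards [Ioo_mem_nhdsGT hr₀] with r hr
    refine (Filter.limsup_le_of_le (by isBoundedDefault) ?_).trans hNe
    filter_upwards [hev, eventually_ge_atTop k₀] with j hj hjk
    refine hj _ ?_ ?_
    · rintro γ ⟨⟨x₀, hx₀, h₀⟩, ⟨x₁, hx₁, h₁⟩⟩
      exact ⟨x₀, x₁, h₀.symm, h₁.symm, (show dist x₀ z = r from hx₀.1).le.trans hr.2.le,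
        hfr z R hRU x₁ hx₁⟩
    · intro γ _
      exact Or.inr fun x hx => (show dist x z < r₀ from hk₀ j hjk hx).le
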